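/- Let $K$ be a field of characteristic $0$, let $e\ge 1$ be an integer, and let $R(t)\in K[[t]]$ be a power series (with coefficients not involving $q$) such that $R(0)\neq 0$. Define $$G_e(R)=\exp\Big[-\sum_{n,m,j>0} j\cdot\frac1m\,[z^{me+j}]\{R(z)^m\}\cdot\frac1n\,[z^{ne-j}]\{R(z)^n\}\;q^{n+m}\Big]\in K[[q]],$$ where $[z^k]$ denotes the coefficient of $z^k$ (which is $0$ for $k<0$). For a field extension $L/K$, a Newton--Puiseux solution over $L$ of the equation $$H^e=q\,R(H)$$ is a Puiseux series $H\in\bigcup_{d\ge1}L((q^{1/d}))$ of positive order in $q$ that satisfies it. If $L$ is algebraically closed, then there are exactly $e$ different Newton--Puiseux solutions over $L$. For any field extension $L/K$ over which there are $e$ different Newton--Puiseux solutions $H_1,\dots,H_e$, the identity $$G_e(R)=\prod_{i=1}^e\frac{R(H_i)}{R(0)}\cdot\prod_{i=1}^e H_i^{e}\cdot\prod_{i_1\neq i_2}\frac{1}{H_{i_2}-H_{i_1}}\cdot\prod_{i=1}^e\Big(\frac{e}{H_i}-\frac{R'(H_i)}{R(H_i)}\Big)$$ holds in the field of Puiseux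 series over $L$, where the third product runs over all ordered pairs $(i_1,i_2)$ with $1\le i_1,i_2\le e$ and $i_1\ne i_2$. -/

import Mathlib

noncomputable section

namespace NewtonPuiseux

open PowerSeries

/-- The power series in `q` (the variable of the result)
`∑_{n, m, j > 0} j · (1/m) [z^{me+j}] R^m · (1/n) [z^{ne-j}] R^n · q^{n+m}`.
For `j > n e` the exponent `ne - j` is negative and the coefficient `[z^{ne-j}] R^n` is zero, so
that the sum over `j` runs over `1 ≤ j ≤ n e`, and the coefficient of each `q^N` is a finite sum. -/
def exponentSeries {K : Type*} [Field K] (e : ℕ) (R : K⟦X⟧) : K⟦X⟧ :=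
  PowerSeries.mk fun N =>
    ∑ p ∈ (Finset.HasAntidiagonal.antidiagonal N).filter (fun p => 0 < p.1 ∧ 0 < p.2),
      ∑ j ∈ Finset.Icc 1 (p.1 * e),
        (j : K) * ((1 / (p.2 : K)) * coeff (p.2 * e + j) (R ^ p.2)) *
          ((1 / (p.1 : K)) * coeff (p.1 * e - j) (R ^ p.1))

/-- The exponent has no constant term, so it may be substituted into the exponential series. -/
theorem hasSubst_neg_exponentSeries {K : Type*} [Field K] (e : ℕ) (R : K⟦X⟧) :
    PowerSeries.HasSubst (-exponentSeries e R) := by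
  apply PowerSeries.HasSubst.of_constantCoeff_zero'
  rw [map_neg, neg_eq_zero, ← PowerSeries.coeff_zero_eq_constantCoeff_apply]
  simp [exponentSeries, Finset.filter_singleton]

/-- `G_e(R) = exp (-∑_{n, m, j > 0} …)`, a power series in `q` with coefficients in `K`. -/
def G {K : Type*} [Field K] [CharZero K] (e : ℕ) (R : K⟦X⟧) : K⟦X⟧ :=
  (PowerSeries.exp K).subst (-exponentSeries e R)

/-- A Hahn series in `q` with rational exponents is a (Newton–)Puiseux series if its exponents
have a common denominator `d > 0`. (They are bounded below, as the support is well-ordered.) -/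
def IsPuiseux {L : Type*} [Field L] (H : HahnSeries ℚ L) : Prop :=
  ∃ d : ℕ, 0 < d ∧ ∀ a ∈ H.support, ∃ k : ℤ, a = (k : ℚ) / (d : ℚ)

/-- A power series `f` over `K` evaluated at a Hahn series `H` over an extension `L` of `K`;
this is `∑ n, f_n H^n` if `H` has positive order, the only case in which it is used. -/
def evalAt {K L : Type*} [Field K] [Field L] [Algebra K L] (f : K⟦X⟧) (H : HahnSeries ℚ L) :
    HahnSeries ℚ L :=
  PowerSeries.heval H (PowerSeries.map (algebraMap K L) f)

/-- A power series in `q` over `K`, seen as a series with rational exponents over `L`. -/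
def toHahn {K : Type*} (L : Type*) [Field K] [Field L] [Algebra K L] (f : K⟦X⟧) :
    HahnSeries ℚ L :=
  HahnSeries.ofPowerSeries ℚ L (PowerSeries.map (algebraMap K L) f)

/-- The Newton–Puiseux solutions over `L` of `H^e = q R(H)`: the Puiseux series `H` in `q` of
positive order (so that `R(H)` makes sense) that satisfy the equation. -/
def solutions {K : Type*} (L : Type*) [Field K] [Field L] [Algebra K L] (e : ℕ) (R : K⟦X⟧) :
    Set (HahnSeries ℚ L) :=
  {H | IsPuiseux H ∧ 0 < H.orderTop ∧ H ^ e = HahnSeries.single (1 : ℚ) (1 : L) * evalAt R H}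

end NewtonPuiseux

end

/-! Put `r = R(0)`, `R = r ρ^e` with `ρ(0) = 1`, and let `ψ(x) = x σ(x)` be the compositional
inverse of `z / ρ(z)`, so that `ψ(x) = x ρ(ψ(x))`, that is, `ρ(ψ) = σ`. With `s = q^(1/e)` the
equation reads `(H / ρ(H))^e = r s^e`, so its solutions are `H_i = ψ(c_i s)` with `c_i^e = r`
(`equation_iff`).

Let `Λ(x, z) = posLog ρ` be the part of positive degree in `z` of `-log (1 - x ρ(z) / z)`. Lagrange
inversion expands the powers `ψ(b s)^j`, so `Λ(a s, ψ(b s))` is the sum of `j · (1/m) [z^(m+j)] ρ^m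
· (1/n) [z^(n-j)] ρ^n · a^m b^n s^(m+n)`. Summing over all `a = c_i`, `b = c_j` keeps only the `m`,
`n` divisible by `e` and yields the sum in the exponent of `G e R` (`exponentSeries_subst`). Hence
`G e R` is the product over all pairs `(i, j)` of `exp (-Λ(c_i s, ψ(c_j s)))` (`G_subst`).

The factors come from `z - x ρ(z) = (z - ψ(x)) · (x / ψ(x)) · exp (-Λ(x, z))` (`exp_posLog_mul`),
evaluated at `x = a s`, `z = ψ(b s)`. For `a ≠ b` it gives `(b - a) s σ(a s) σ(b s) / (ψ(b s) - ψ(a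
s))`. For `a = b` both sides vanish, and the derivative in `z` gives `(1 - a s ρ'(ψ(a s))) σ(a s)`
instead. Since `∏_{i ≠ j} (c_j - c_i) = e c_j^(e-1)`, the product of all factors is the right-hand
side (`prod_prod_eq_of_mul_sub_eq`). -/

namespace PowerSeries

/-! ### Linear differential equations and the exponential of a power series -/

section ODE

variable {A : Type*} [CommRing A]

/-- The equation expresses `n + 1` times coefficient `n + 1` through lower coefficients. Rings
without additive torsion, rather than fields, are allowed because `A = K⟦X⟧` is needed for series in
two variables. -/
theorem eq_zero_of_derivative_eq_mul [IsAddTorsionFree A] {f u : A⟦X⟧}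
    (hf : d⁄dX A f = u * f) (h0 : constantCoeff f = 0) : f = 0 := by
  ext n
  induction n using Nat.strong_induction_on with
  | _ n ih =>
    cases n with
    | zero => simpa using h0
    | succ n =>
      have h := congrArg (coeff n) hf
      rw [coeff_derivative, coeff_mul, Finset.sum_eq_zero] at h
      · have h' : (n + 1) • coeff (n + 1) f = 0 := by
          rw [nsmul_eq_mul, mul_comm]; exact_mod_cast h
        simpa using (smul_eq_zero_iff_right n.succ_ne_zero).1 h'
      · intro p hp
        have := Finset.HasAntidiagonal.mem_antidiagonal.1 hp
        rw [ih p.2 (by omega), map_zero, mul_zero]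

theorem eq_of_derivative_eq_mul [IsAddTorsionFree A] {f g u : A⟦X⟧}
    (hf : d⁄dX A f = u * f) (hg : d⁄dX A g = u * g)
    (h0 : constantCoeff f = constantCoeff g) : f = g := by
  refine sub_eq_zero.1 (eq_zero_of_derivative_eq_mul (u := u) ?_ ?_)
  · rw [map_sub, hf, hg, mul_sub]
  · rw [map_sub, h0, sub_self]

/-- Modulo `g ^ N`, the series `f(g)` only involves the first `N` coefficients of `f`. -/
theorem pow_dvd_subst_sub_sum (f : A⟦X⟧) {g : A⟦X⟧} (hg : constantCoeff g = 0) (N : ℕ) :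
    g ^ N ∣ f.subst g - ∑ k ∈ Finset.range N, C (coeff k f) * g ^ k := by
  have hs : HasSubst g := HasSubst.of_constantCoeff_zero' hg
  have hf : f = (trunc N f : A⟦X⟧) + X ^ N * mk fun i => coeff (i + N) f := by
    rw [add_comm]; exact eq_X_pow_mul_shift_add_trunc N f
  have h2 : (trunc N f : A⟦X⟧).subst g = ∑ k ∈ Finset.range N, C (coeff k f) * g ^ k := by
    rw [subst_coe hs, trunc_apply, Nat.Ico_zero_eq_range, map_sum]
    refine Finset.sum_congr rfl fun k _ => ?_
    rw [Polynomial.aeval_monomial]; rfl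
  refine ⟨(mk fun i => coeff (i + N) f).subst g, ?_⟩
  rw [sub_eq_iff_eq_add', ← h2]
  conv_lhs => rw [hf]
  rw [subst_add hs, subst_mul hs, subst_pow hs, subst_X hs]

variable [Algebra ℚ A]

theorem derivative_exp_subst {g : A⟦X⟧} (hg : constantCoeff g = 0) :
    d⁄dX A ((exp A).subst g) = d⁄dX A g * (exp A).subst g := by
  rw [derivative_subst (HasSubst.of_constantCoeff_zero' hg), derivative_exp, mul_comm]

theorem constantCoeff_exp_subst {g : A⟦X⟧} (hg : constantCoeff g = 0) :
    constantCoeff ((exp A).subst g : A⟦X⟧) = 1 := by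
  obtain ⟨r, hr⟩ := pow_dvd_subst_sub_sum (exp A) hg 1
  have := congrArg constantCoeff hr
  simp [hg] at this
  linear_combination this

theorem exp_subst_zero : (exp A).subst (0 : A⟦X⟧) = (1 : A⟦X⟧) := by
  rw [subst_zero_eq_C_constantCoeff]; simp

theorem exp_subst_add {g h : A⟦X⟧} (hg : constantCoeff g = 0) (hh : constantCoeff h = 0) :
    (exp A).subst (g + h) = (exp A).subst g * (exp A).subst h := by
  have : IsAddTorsionFree A := IsAddTorsionFree.of_module_rat A
  have hgh : constantCoeff (g + h) = 0 := by rw [map_add, hg, hh, add_zero]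
  refine eq_of_derivative_eq_mul (derivative_exp_subst hgh) ?_ ?_
  · rw [Derivation.leibniz, derivative_exp_subst hg, derivative_exp_subst hh, map_add,
      smul_eq_mul, smul_eq_mul]
    ring
  · rw [map_mul, constantCoeff_exp_subst hgh, constantCoeff_exp_subst hg,
      constantCoeff_exp_subst hh, one_mul]

theorem exp_subst_sum {ι : Type*} (s : Finset ι) (g : ι → A⟦X⟧)
    (hg : ∀ i ∈ s, constantCoeff (g i) = 0) :
    (exp A).subst (∑ i ∈ s, g i) = ∏ i ∈ s, (exp A).subst (g i) := by
  classical
  induction s using Finset.induction_on with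
  | empty => simpa using exp_subst_zero
  | insert i s hi ih =>
    rw [Finset.sum_insert hi, Finset.prod_insert hi, exp_subst_add (hg i (by simp)), ih]
    · exact fun j hj => hg j (by simp [hj])
    · rw [map_sum]; exact Finset.sum_eq_zero fun j hj => hg j (by simp [hj])

/-- A ring homomorphism that is continuous for the `X`-adic topologies commutes with `exp`. -/
theorem map_exp_subst {A' : Type*} [CommRing A'] [Algebra ℚ A'] (Φ : A⟦X⟧ →+* A'⟦X⟧)
    (hΦ : (X : A'⟦X⟧) ∣ Φ X) {g : A⟦X⟧} (hg : constantCoeff g = 0) :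
    Φ ((exp A).subst g) = (exp A').subst (Φ g) := by
  obtain ⟨t, ht⟩ := hΦ
  obtain ⟨g', rfl⟩ := X_dvd_iff.2 hg
  have h' : constantCoeff (Φ (X * g')) = 0 := by rw [map_mul, ht]; simp
  rw [← sub_eq_zero]
  ext n
  obtain ⟨r, hr⟩ := pow_dvd_subst_sub_sum (exp A) hg (n + 1)
  obtain ⟨r', hr'⟩ := pow_dvd_subst_sub_sum (exp A') h' (n + 1)
  have key : Φ (∑ k ∈ Finset.range (n + 1), C (coeff k (exp A)) * (X * g') ^ k) =
      ∑ k ∈ Finset.range (n + 1), C (coeff k (exp A')) * (Φ (X * g')) ^ k := by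
    rw [map_sum]
    refine Finset.sum_congr rfl fun k _ => ?_
    rw [map_mul, map_pow, coeff_exp, coeff_exp]
    congr 1
    have h1 := RingHom.map_rat_algebraMap (Φ.comp C) (1 / k.factorial : ℚ)
    have h2 := RingHom.map_rat_algebraMap (C : A' →+* A'⟦X⟧) (1 / k.factorial : ℚ)
    exact h1.trans h2.symm
  have hd : Φ ((exp A).subst (X * g')) - (exp A').subst (Φ (X * g')) =
      X ^ (n + 1) * ((t * Φ g') ^ (n + 1) * (Φ r - r')) := by
    rw [sub_eq_iff_eq_add.1 hr, sub_eq_iff_eq_add.1 hr', map_add, key, map_mul, map_pow,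
      map_mul, ht]
    ring
  rw [hd, coeff_X_pow_mul', if_neg (by omega), map_zero]

end ODE

/-! ### Roots of power series, formal residues and Lagrange inversion -/

section Field

variable {K : Type*} [Field K] [CharZero K]

theorem exists_derivative_eq (u : K⟦X⟧) : ∃ g : K⟦X⟧, d⁄dX K g = u ∧ constantCoeff g = 0 := by
  refine ⟨mk fun n => coeff (n - 1) u / n, ?_, ?_⟩
  · ext n
    rw [coeff_derivative, coeff_mk, Nat.add_sub_cancel]
    push_cast
    exact div_mul_cancel₀ _ (Nat.cast_add_one_ne_zero n)
  · rw [← coeff_zero_eq_constantCoeff_apply, coeff_mk]; simp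

/-- The root is the exponential of a primitive of `f' / (e f)`: its `e`-th power has the same
logarithmic derivative and constant term as `f`. -/
theorem exists_pow_eq {e : ℕ} (he : e ≠ 0) {f : K⟦X⟧} (hf : constantCoeff f = 1) :
    ∃ ρ : K⟦X⟧, ρ ^ e = f ∧ constantCoeff ρ = 1 := by
  obtain ⟨g, hg, hg0⟩ := exists_derivative_eq (C (e : K)⁻¹ * (f⁻¹ * d⁄dX K f))
  have he' : (C (e : K) : K⟦X⟧) * C (e : K)⁻¹ = 1 := by
    rw [← map_mul, mul_inv_cancel₀ (Nat.cast_ne_zero.2 he), map_one]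
  have hff : f⁻¹ * f = 1 := PowerSeries.inv_mul_cancel f (by rw [hf]; exact one_ne_zero)
  refine ⟨(exp K).subst g, ?_, constantCoeff_exp_subst hg0⟩
  refine eq_of_derivative_eq_mul (u := f⁻¹ * d⁄dX K f) ?_ ?_ ?_
  · rw [derivative_pow, derivative_exp_subst hg0, hg]
    obtain ⟨k, rfl⟩ := Nat.exists_eq_succ_of_ne_zero he
    rw [Nat.succ_sub_one, pow_succ, ← map_natCast (C : K →+* K⟦X⟧)]
    linear_combination (f⁻¹ * d⁄dX K f) * ((exp K).subst g) ^ k * (exp K).subst g * he'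
  · linear_combination (-d⁄dX K f) * hff
  · rw [map_pow, constantCoeff_exp_subst hg0, one_pow, hf]

/-- With `ψ = X * σ` this is the residue of `ψ' / ψ^(M+1)`. For `M > 0` the form is exact, being a
multiple of the derivative of `ψ^(-M)`; for `M = 0` it is a logarithmic derivative. -/
theorem coeff_inv_pow_mul_derivative {σ : K⟦X⟧} (hσ : constantCoeff σ = 1) (M : ℕ) :
    coeff M (σ⁻¹ ^ (M + 1) * d⁄dX K (X * σ)) = if M = 0 then 1 else 0 := by
  have hi : σ⁻¹ * σ = 1 := PowerSeries.inv_mul_cancel σ (by rw [hσ]; exact one_ne_zero)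
  have hd : d⁄dX K (X * σ) = σ + X * d⁄dX K σ := by
    rw [Derivation.leibniz, derivative_X, smul_eq_mul, smul_eq_mul]; ring
  cases M with
  | zero =>
    rw [hd, if_pos rfl, coeff_zero_eq_constantCoeff_apply]
    simp [hσ]
  | succ M =>
    have h1 : σ⁻¹ ^ (M + 1 + 1) * d⁄dX K (X * σ) =
        σ⁻¹ ^ (M + 1) + X * (σ⁻¹ ^ (M + 1 + 1) * d⁄dX K σ) := by
      rw [hd]; linear_combination σ⁻¹ ^ (M + 1) * hi
    have h2 : d⁄dX K (σ⁻¹ ^ (M + 1)) =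
        -(C ((M : K) + 1) * (σ⁻¹ ^ (M + 1 + 1) * d⁄dX K σ)) := by
      rw [derivative_pow, derivative_inv', Nat.add_sub_cancel]
      push_cast
      rw [map_add, map_natCast, map_one]
      ring
    have h3 := congrArg (coeff M) h2
    rw [coeff_derivative, map_neg, coeff_C_mul] at h3
    rw [h1, map_add, coeff_succ_X_mul, if_neg M.succ_ne_zero]
    have : ((M : K) + 1) ≠ 0 := Nat.cast_add_one_ne_zero M
    apply mul_left_cancel₀ this
    linear_combination h3

/-- The change of variables formula for formal residues. -/
theorem coeff_subst_mul_inv_pow_mul_derivative {σ : K⟦X⟧} (hσ : constantCoeff σ = 1) (f : K⟦X⟧)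
    (N : ℕ) :
    coeff N (f.subst (X * σ) * (σ⁻¹ ^ (N + 1) * d⁄dX K (X * σ))) = coeff N f := by
  have hi : σ * σ⁻¹ = 1 := PowerSeries.mul_inv_cancel σ (by rw [hσ]; exact one_ne_zero)
  -- Terms `f_k ψ^k` with `k > N` do not reach degree `N`; the others reduce to the residue of `ψ' /
  -- ψ^(M+1)` with `M = N - k`.
  obtain ⟨r, hr⟩ := pow_dvd_subst_sub_sum f (g := X * σ) (by simp) (N + 1)
  rw [sub_eq_iff_eq_add.1 hr, add_mul, map_add, mul_pow, mul_assoc, mul_assoc,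
    coeff_X_pow_mul', if_neg (by omega), zero_add, Finset.sum_mul, map_sum]
  have : ∀ k ∈ Finset.range (N + 1), coeff N (C (coeff k f) * (X * σ) ^ k *
      (σ⁻¹ ^ (N + 1) * d⁄dX K (X * σ))) = if N = k then coeff k f else 0 := by
    intro k hk
    obtain ⟨M, rfl⟩ := Nat.exists_eq_add_of_le (Nat.lt_succ_iff.1 (Finset.mem_range.1 hk))
    have h1 : C (coeff k f) * (X * σ) ^ k * (σ⁻¹ ^ (k + M + 1) * d⁄dX K (X * σ)) =
        C (coeff k f) * (X ^ k * (σ⁻¹ ^ (M + 1) * d⁄dX K (X * σ))) := by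
      have : σ ^ k * σ⁻¹ ^ k = 1 := by rw [← mul_pow, hi, one_pow]
      linear_combination C (coeff k f) * X ^ k * σ⁻¹ ^ (M + 1) * d⁄dX K (X * σ) * this
    rw [h1, coeff_C_mul, coeff_X_pow_mul', if_pos (by omega), Nat.add_sub_cancel_left,
      coeff_inv_pow_mul_derivative hσ]
    by_cases hM : M = 0 <;> simp [hM]
  rw [Finset.sum_congr rfl this, Finset.sum_ite_eq, if_pos (by simp)]

variable {ρ σ : K⟦X⟧}

/-- The residue formula for `f = ρ^(m+k+1)`, where `f(ψ) = σ^(m+k+1)`. It covers the coefficients of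
`ρ^n` in degrees below `n`; `coeff_pow_self` treats degree `n`, where the power of `σ` left over is
`σ⁻¹` and a logarithmic derivative appears. -/
theorem coeff_pow_eq_of_lt (hσ : constantCoeff σ = 1) (h : ρ.subst (X * σ) = σ) (m k : ℕ) :
    coeff m (ρ ^ (m + k + 1)) = coeff m (σ ^ k * d⁄dX K (X * σ)) := by
  have hi : σ * σ⁻¹ = 1 := PowerSeries.mul_inv_cancel σ (by rw [hσ]; exact one_ne_zero)
  rw [← coeff_subst_mul_inv_pow_mul_derivative hσ,
    subst_pow (HasSubst.of_constantCoeff_zero' (by simp)), h]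
  have : σ ^ (m + 1) * σ⁻¹ ^ (m + 1) = 1 := by rw [← mul_pow, hi, one_pow]
  congr 1
  linear_combination σ ^ k * d⁄dX K (X * σ) * this

theorem coeff_pow_self (hσ : constantCoeff σ = 1) (h : ρ.subst (X * σ) = σ) (m : ℕ) :
    coeff (m + 1) (ρ ^ (m + 1)) = coeff m (σ⁻¹ * d⁄dX K σ) := by
  have hi : σ * σ⁻¹ = 1 := PowerSeries.mul_inv_cancel σ (by rw [hσ]; exact one_ne_zero)
  rw [← coeff_subst_mul_inv_pow_mul_derivative hσ,
    subst_pow (HasSubst.of_constantCoeff_zero' (by simp)), h]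
  have : σ ^ (m + 1) * σ⁻¹ ^ (m + 1) = 1 := by rw [← mul_pow, hi, one_pow]
  have hd : d⁄dX K (X * σ) = σ + X * d⁄dX K σ := by
    rw [Derivation.leibniz, derivative_X, smul_eq_mul, smul_eq_mul]; ring
  have h1 : σ ^ (m + 1) * (σ⁻¹ ^ (m + 1 + 1) * d⁄dX K (X * σ)) = 1 + X * (σ⁻¹ * d⁄dX K σ) := by
    rw [hd]
    linear_combination σ⁻¹ * (σ + X * d⁄dX K σ) * this + hi
  rw [h1, map_add, coeff_succ_X_mul, coeff_one, if_neg m.succ_ne_zero, zero_add]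

/-- Lagrange inversion. -/
theorem lagrange_inversion (hσ : constantCoeff σ = 1) (h : ρ.subst (X * σ) = σ) (m k : ℕ) :
    ((m + k + 1 : ℕ) : K) * coeff (m + k + 1) ((X * σ) ^ (k + 1)) =
      ((k + 1 : ℕ) : K) * coeff m (ρ ^ (m + k + 1)) := by
  have h1 : d⁄dX K ((X * σ) ^ (k + 1)) =
      C ((k + 1 : ℕ) : K) * (X ^ k * (σ ^ k * d⁄dX K (X * σ))) := by
    rw [derivative_pow, Nat.add_sub_cancel, map_natCast]; ring
  have h2 := congrArg (coeff (m + k)) h1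
  rw [coeff_derivative, coeff_C_mul, coeff_X_pow_mul', if_pos (by omega), Nat.add_sub_cancel,
    ← coeff_pow_eq_of_lt hσ h] at h2
  rw [← h2]
  push_cast
  ring

end Field

end PowerSeries

namespace PowerSeries

/-! ### The factorization of `z - x ρ(z)` in `K⟦z⟧⟦x⟧` -/

section Factorization

variable {K : Type*} [Field K] [CharZero K]

/-- The part of positive degree of `(ρ(z) / z) ^ n`. -/
noncomputable def posPart (ρ : K⟦X⟧) (n : ℕ) : K⟦X⟧ :=
  mk fun j => if j = 0 then 0 else coeff (n + j) (ρ ^ n)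

/-- The part of positive degree in `z` of `-log (1 - x ρ(z) / z)`. -/
noncomputable def posLog (ρ : K⟦X⟧) : K⟦X⟧⟦X⟧ :=
  mk fun n => C ((n : K)⁻¹) * posPart ρ n

theorem constantCoeff_posLog (ρ : K⟦X⟧) : constantCoeff (posLog ρ) = 0 := by
  rw [← coeff_zero_eq_constantCoeff_apply, posLog, coeff_mk]; simp

theorem coeff_derivative_posLog (ρ : K⟦X⟧) (n : ℕ) :
    coeff n (d⁄dX K⟦X⟧ (posLog ρ)) = posPart ρ (n + 1) := by
  have h : ((n : K) + 1) ≠ 0 := Nat.cast_add_one_ne_zero n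
  have h1 : (C ((n : K) + 1)⁻¹ : K⟦X⟧) * C ((n : K) + 1) = 1 := by
    rw [← map_mul, inv_mul_cancel₀ h, map_one]
  have h2 : ((n : K⟦X⟧) + 1) = C ((n : K) + 1) := by simp
  rw [coeff_derivative, posLog, coeff_mk, h2]
  push_cast
  linear_combination posPart ρ (n + 1) * h1

theorem derivative_mul {A : Type*} [CommRing A] (f g : A⟦X⟧) :
    d⁄dX A (f * g) = f * d⁄dX A g + g * d⁄dX A f :=
  (d⁄dX A).leibniz f g

theorem derivative_rescale {A : Type*} [CommRing A] (a : A) (f : A⟦X⟧) :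
    d⁄dX A (rescale a f) = C a * rescale a (d⁄dX A f) := by
  ext n
  rw [coeff_derivative, coeff_rescale, coeff_C_mul, coeff_rescale, coeff_derivative]
  ring

theorem derivative_map {A A' : Type*} [CommRing A] [CommRing A'] (φ : A →+* A') (f : A⟦X⟧) :
    d⁄dX A' (map φ f) = map φ (d⁄dX A f) := by
  ext n
  simp [coeff_derivative]

variable {ρ σ : K⟦X⟧}

theorem coeff_mul_geom {A : Type*} [CommRing A] {N S P : A⟦X⟧} (h : N * (1 - X * S) = P) (n : ℕ) :
    coeff n N = ∑ k ∈ Finset.range (n + 1), coeff (n - k) (S ^ k * P) := by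
  have h1 : N = (∑ k ∈ Finset.range (n + 1), (X * S) ^ k) * P + X ^ (n + 1) * (S ^ (n + 1) * N) := by
    have := geom_sum_mul_neg (X * S) (n + 1)
    rw [← h]
    linear_combination (-N) * this
  conv_lhs => rw [h1]
  rw [map_add, coeff_X_pow_mul', if_neg (by omega), add_zero, Finset.sum_mul, map_sum]
  refine Finset.sum_congr rfl fun k hk => ?_
  rw [mul_pow, mul_assoc, coeff_X_pow_mul', if_pos (Nat.lt_succ_iff.1 (Finset.mem_range.1 hk))]

theorem coeff_C_X_rescale {K : Type*} [Field K] (f : K⟦X⟧) (n : ℕ) :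
    coeff n (rescale (X : K⟦X⟧) (map C f)) = C (coeff n f) * X ^ n := by
  rw [coeff_rescale, coeff_map, mul_comm]

/-- Replacing `x` by `x z` clears the denominators of `ρ(z) / z`. Both sides then have constant term
`1` and the same logarithmic derivative in `x`; comparing the latter is a statement about the
coefficients of the powers of `ρ`. -/
theorem exp_posLog_rescale (hσ : constantCoeff σ = 1) (h : ρ.subst (X * σ) = σ) :
    rescale (X : K⟦X⟧) ((exp K⟦X⟧).subst (-posLog ρ)) *
        (1 - X * rescale (X : K⟦X⟧) (map C σ)) =
      (1 - X * C ρ) * rescale (X : K⟦X⟧) (map C σ) := by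
  have hi : σ * σ⁻¹ = 1 := PowerSeries.mul_inv_cancel σ (by rw [hσ]; exact one_ne_zero)
  have h0 : constantCoeff (-posLog ρ) = 0 := by rw [map_neg, constantCoeff_posLog, neg_zero]
  have : IsAddTorsionFree K⟦X⟧ := IsAddTorsionFree.of_module_rat _
  set E := rescale (X : K⟦X⟧) ((exp K⟦X⟧).subst (-posLog ρ)) with hE
  set S := rescale (X : K⟦X⟧) (map C σ) with hS
  set γ := C X * rescale (X : K⟦X⟧) (d⁄dX K⟦X⟧ (posLog ρ)) with hγ
  set P := rescale (X : K⟦X⟧) (map C (d⁄dX K (X * σ))) with hP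
  set Z := C X * rescale (X : K⟦X⟧) (map C (σ⁻¹ * d⁄dX K σ)) with hZ
  have hSc : constantCoeff S = 1 := by
    rw [← coeff_zero_eq_constantCoeff_apply, hS, coeff_C_X_rescale]; simp [hσ]
  have hE' : d⁄dX K⟦X⟧ E = -γ * E := by
    rw [hE, derivative_rescale, derivative_exp_subst h0, map_mul, map_neg, map_neg, hγ]; ring
  have hS' : d⁄dX K⟦X⟧ S = Z * S := by
    rw [hS, derivative_rescale, derivative_map, hZ, mul_assoc, ← map_mul, ← map_mul]
    congr 4
    linear_combination (-d⁄dX K σ) * hi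
  have hPS : P = S + X * d⁄dX K⟦X⟧ S := by
    have hd : d⁄dX K (X * σ) = σ + X * d⁄dX K σ := by
      rw [derivative_mul, derivative_X, mul_one]; ring
    rw [hP, hd, hS, derivative_rescale, derivative_map, map_add, map_mul, map_X, map_add, map_mul,
      rescale_X]
    ring
  -- `-F` and `-N` are the logarithmic derivatives in `x` of `1 - x ρ(z)` and of `1 - x S`; those of
  -- `E` and `S` are `-γ` and `Z`.
  obtain ⟨F, hF⟩ : ∃ F, F * (1 - X * C ρ) = C ρ := by
    have : IsUnit (1 - X * C ρ : K⟦X⟧⟦X⟧) := by rw [isUnit_iff_constantCoeff]; simp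
    exact ⟨C ρ * ↑this.unit⁻¹, by rw [mul_assoc, this.val_inv_mul, mul_one]⟩
  obtain ⟨N, hN⟩ : ∃ N, N * (1 - X * S) = P := by
    have : IsUnit (1 - X * S : K⟦X⟧⟦X⟧) := by rw [isUnit_iff_constantCoeff]; simp
    exact ⟨P * ↑this.unit⁻¹, by rw [mul_assoc, this.val_inv_mul, mul_one]⟩
  have key : γ + N = F - Z := by
    rw [eq_sub_iff_add_eq]
    ext n m
    have hFn : coeff n F = ρ ^ (n + 1) := by
      rw [coeff_mul_geom hF, Finset.sum_eq_single n]
      · rw [Nat.sub_self, ← map_pow, ← map_mul, coeff_zero_eq_constantCoeff_apply,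
          constantCoeff_C, pow_succ]
      · intro k hk hkn
        have := Finset.mem_range.1 hk
        rw [← map_pow, ← map_mul, coeff_C, if_neg (by omega)]
      · simp
    have hNn : coeff n N = ∑ k ∈ Finset.range (n + 1),
        C (coeff (n - k) (σ ^ k * d⁄dX K (X * σ))) * X ^ (n - k) := by
      rw [coeff_mul_geom hN]
      refine Finset.sum_congr rfl fun k _ => ?_
      rw [hS, hP, ← map_pow, ← map_mul, ← map_pow, ← map_mul, coeff_C_X_rescale]
    have hγn : coeff n γ = X ^ (n + 1) * posPart ρ (n + 1) := by
      rw [hγ, coeff_C_mul, coeff_rescale, coeff_derivative_posLog]; ring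
    have hZn : coeff n Z = C (coeff n (σ⁻¹ * d⁄dX K σ)) * X ^ (n + 1) := by
      rw [hZ, coeff_C_mul, coeff_C_X_rescale]; ring
    rw [map_add, map_add, map_add, map_add, hFn, hNn, hγn, hZn, coeff_X_pow_mul', map_sum,
      coeff_C_mul, coeff_X_pow]
    simp_rw [coeff_C_mul, coeff_X_pow]
    -- At `x^n z^m` the series `F` has the coefficient `[z^m] ρ^(n+1)`. It is matched by `N` if `m <
    -- n + 1`, by `Z` if `m = n + 1`, and by `γ` if `m > n + 1`.
    rcases lt_trichotomy m (n + 1) with hm | hm | hm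
    · rw [if_neg (by omega), if_neg (by omega), Finset.sum_eq_single (n - m)]
      · have hn : n + 1 = m + (n - m) + 1 := by omega
        have hn' : n - (n - m) = m := by omega
        rw [hn', if_pos rfl]
        conv_rhs => rw [hn, coeff_pow_eq_of_lt hσ h]
        ring
      · intro k hk hkm
        have := Finset.mem_range.1 hk
        rw [if_neg (by omega), mul_zero]
      · intro hk
        exact absurd (Finset.mem_range.2 (by omega)) hk
    · subst hm
      rw [if_pos le_rfl, if_pos rfl, Finset.sum_eq_zero, coeff_pow_self hσ h]
      · simp [posPart]
      · intro k _
        rw [if_neg (by omega), mul_zero]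
    · rw [if_pos hm.le, if_neg (by omega), Finset.sum_eq_zero]
      · rw [posPart, coeff_mk, if_neg (by omega)]
        have : n + 1 + (m - (n + 1)) = m := by omega
        rw [this]; ring
      · intro k _
        rw [if_neg (by omega), mul_zero]
  refine eq_of_derivative_eq_mul (u := -(γ + N)) ?_ ?_ ?_
  · rw [derivative_mul, hE', map_sub, derivative_mul, derivative_one, derivative_X]
    linear_combination E * hPS + E * hN
  · rw [key, derivative_mul, hS', map_sub, derivative_mul, derivative_one, derivative_X,
      derivative_C]
    linear_combination S * hF
  · rw [map_mul, map_mul, hSc]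
    have : constantCoeff E = 1 := by
      rw [← coeff_zero_eq_constantCoeff_apply, hE, coeff_rescale,
        coeff_zero_eq_constantCoeff_apply, constantCoeff_exp_subst h0]
      simp
    rw [this]; simp

/-- The factorization of `z - x ρ(z)`, where `X * σ` is the series `ψ` with `ψ(x) = x ρ(ψ(x))`. -/
theorem exp_posLog_mul (hσ : constantCoeff σ = 1) (h : ρ.subst (X * σ) = σ) :
    (exp K⟦X⟧).subst (-posLog ρ) * (C X - map C (X * σ)) * X =
      (C X - X * C ρ) * map C (X * σ) := by
  -- The substitution `x ↦ x z` loses nothing, so the identity may be checked after it.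
  apply rescale_injective (X_ne_zero (R := K))
  have hC : ∀ a : K⟦X⟧, rescale (X : K⟦X⟧) (C a) = C a := fun a => by
    ext n; rw [coeff_rescale, coeff_C]; split_ifs with hn <;> simp [hn]
  have := exp_posLog_rescale hσ h
  simp only [map_mul, map_sub, rescale_X, map_X]
  rw [hC, hC]
  linear_combination C X * C X * X * this

end Factorization

end PowerSeries

namespace PowerSeries

/-! ### Evaluation of series over `K⟦X⟧` at a multiple of `X` -/

section AdicEval

variable {K : Type*} [Field K]

/-- The value at `t` of a power series with coefficients in `K⟦X⟧`; it is used for `t` divisible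
by `X`. -/
noncomputable def adicEvalFun (t : K⟦X⟧) (F : K⟦X⟧⟦X⟧) : K⟦X⟧ :=
  mk fun N => coeff N ((trunc (N + 1) F).eval t)

theorem coeff_adicEvalFun {t : K⟦X⟧} (ht : X ∣ t) {F : K⟦X⟧⟦X⟧} {P : Polynomial K⟦X⟧} {N : ℕ}
    (h : ∀ k ≤ N, P.coeff k = coeff k F) : coeff N (adicEvalFun t F) = coeff N (P.eval t) := by
  obtain ⟨Q, hQ⟩ : Polynomial.X ^ (N + 1) ∣ P - trunc (N + 1) F := by
    rw [Polynomial.X_pow_dvd_iff]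
    intro d hd
    rw [Polynomial.coeff_sub, coeff_trunc, if_pos hd, h d (by omega), sub_self]
  obtain ⟨t', rfl⟩ := ht
  rw [adicEvalFun, coeff_mk, sub_eq_iff_eq_add.1 hQ, Polynomial.eval_add, map_add,
    Polynomial.eval_mul, Polynomial.eval_pow, Polynomial.eval_X, mul_pow, mul_assoc,
    coeff_X_pow_mul', if_neg (by omega), zero_add]

/-- Evaluation at `t ∈ X K⟦X⟧` as a ring homomorphism. -/
noncomputable def adicEval (t : K⟦X⟧) (ht : X ∣ t) : K⟦X⟧⟦X⟧ →+* K⟦X⟧ where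
  toFun := adicEvalFun t
  map_one' := by
    ext N
    rw [coeff_adicEvalFun ht (P := 1), Polynomial.eval_one]
    intro k _
    rw [Polynomial.coeff_one, coeff_one]
  map_zero' := by
    ext N
    rw [coeff_adicEvalFun ht (P := 0), Polynomial.eval_zero]
    intro k _
    simp
  map_add' F G := by
    ext N
    rw [map_add, coeff_adicEvalFun ht (P := trunc (N + 1) F + trunc (N + 1) G),
      Polynomial.eval_add, map_add]
    · simp only [adicEvalFun, coeff_mk]
    · intro k hk
      rw [Polynomial.coeff_add, coeff_trunc, coeff_trunc, if_pos (by omega), if_pos (by omega),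
        map_add]
  map_mul' F G := by
    ext N
    have h : ∀ k ≤ N, (trunc (N + 1) F * trunc (N + 1) G).coeff k = coeff k (F * G) := by
      intro k hk
      rw [Polynomial.coeff_mul, coeff_mul]
      refine Finset.sum_congr rfl fun p hp => ?_
      have := Finset.HasAntidiagonal.mem_antidiagonal.1 hp
      rw [coeff_trunc, coeff_trunc, if_pos (by omega), if_pos (by omega)]
    rw [coeff_adicEvalFun ht h, Polynomial.eval_mul, coeff_mul, coeff_mul]
    refine Finset.sum_congr rfl fun p hp => ?_
    have := Finset.HasAntidiagonal.mem_antidiagonal.1 hp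
    rw [coeff_adicEvalFun ht (P := trunc (N + 1) F), coeff_adicEvalFun ht (P := trunc (N + 1) G)]
    · intro k hk
      rw [coeff_trunc, if_pos (by omega)]
    · intro k hk
      rw [coeff_trunc, if_pos (by omega)]

variable (t : K⟦X⟧) (ht : X ∣ t)

theorem coeff_adicEval (F : K⟦X⟧⟦X⟧) (N : ℕ) :
    coeff N (adicEval t ht F) = ∑ k ∈ Finset.range (N + 1), coeff N (coeff k F * t ^ k) := by
  change coeff N (adicEvalFun t F) = _
  rw [adicEvalFun, coeff_mk, trunc_apply, Nat.Ico_zero_eq_range, Polynomial.eval_finsetSum,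
    map_sum]
  simp only [Polynomial.eval_monomial]

theorem adicEval_C (a : K⟦X⟧) : adicEval t ht (C a) = a := by
  ext N
  rw [coeff_adicEval, Finset.sum_eq_single 0]
  · simp
  · intro k _ hk
    rw [coeff_C, if_neg hk, zero_mul, map_zero]
  · simp

theorem adicEval_X : adicEval t ht X = t := by
  ext N
  change coeff N (adicEvalFun t X) = _
  rw [coeff_adicEvalFun ht (P := Polynomial.X), Polynomial.eval_X]
  intro k _
  rw [Polynomial.coeff_X, coeff_X]
  simp only [eq_comm]

theorem adicEval_map_C (f : K⟦X⟧) : adicEval t ht (map C f) = f.subst t := by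
  ext N
  obtain ⟨r, hr⟩ := pow_dvd_subst_sub_sum f (X_dvd_iff.1 ht) (N + 1)
  obtain ⟨t', rfl⟩ := ht
  rw [sub_eq_iff_eq_add.1 hr, map_add, mul_pow, mul_assoc, coeff_X_pow_mul', if_neg (by omega),
    zero_add, coeff_adicEval, map_sum]
  simp only [coeff_map, mul_pow]

end AdicEval

/-! ### The values of `exp (-posLog ρ)` at `x = a s`, `z = ψ(b s)` -/

section Bivariate

variable {K : Type*} [Field K] {ρ σ : K⟦X⟧}

theorem hasSubst_X_mul (σ : K⟦X⟧) : HasSubst (X * σ : K⟦X⟧) :=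
  HasSubst.of_constantCoeff_zero' (by simp)

/-- Evaluation at `z = ψ(b s)`, `x = a s`, where `ψ = X * σ`. -/
noncomputable def bivEval (σ : K⟦X⟧) (a b : K) : K⟦X⟧⟦X⟧ →+* K⟦X⟧ :=
  (adicEval (C a * X) (dvd_mul_left _ _)).comp
    (map ((rescale b).comp (substAlgHom (R := K) (hasSubst_X_mul σ)).toRingHom))

theorem bivEval_apply (σ : K⟦X⟧) (a b : K) (F : K⟦X⟧⟦X⟧) :
    bivEval σ a b F = adicEval (C a * X) (dvd_mul_left _ _)
      (map ((rescale b).comp (substAlgHom (R := K) (hasSubst_X_mul σ)).toRingHom) F) := rfl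

theorem bivEval_C (a b : K) (f : K⟦X⟧) :
    bivEval σ a b (C f) = rescale b (f.subst (X * σ)) := by
  rw [bivEval_apply, map_C, adicEval_C, ← coe_substAlgHom (hasSubst_X_mul σ)]
  rfl

theorem bivEval_X (a b : K) : bivEval σ a b X = C a * X := by
  rw [bivEval_apply, map_X, adicEval_X]

theorem bivEval_map_C (a b : K) (f : K⟦X⟧) : bivEval σ a b (map C f) = rescale a f := by
  rw [rescale_eq_subst, smul_eq_C_mul, ← adicEval_map_C (C a * X) (dvd_mul_left _ _),
    bivEval_apply]
  congr 1
  ext1 n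
  rw [coeff_map, coeff_map, RingHom.comp_apply]
  have : (substAlgHom (R := K) (hasSubst_X_mul σ)).toRingHom (C (coeff n f)) = C (coeff n f) :=
    (substAlgHom (R := K) (hasSubst_X_mul σ)).commutes (coeff n f)
  rw [this]
  ext m
  rw [coeff_rescale, coeff_C]; split_ifs with hm <;> simp [hm]

theorem coeff_bivEval (a b : K) (F : K⟦X⟧⟦X⟧) (N : ℕ) :
    coeff N (bivEval σ a b F) = ∑ p ∈ Finset.HasAntidiagonal.antidiagonal N,
      a ^ p.2 * (b ^ p.1 * coeff p.1 ((coeff p.2 F).subst (X * σ))) := by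
  rw [bivEval_apply, coeff_adicEval, Finset.Nat.sum_antidiagonal_eq_sum_range_succ_mk,
    ← Finset.sum_range_reflect]
  refine Finset.sum_congr rfl fun k hk => ?_
  have hk' := Finset.mem_range.1 hk
  have h1 : N + 1 - 1 - k = N - k := by omega
  have h2 : N - (N - k) = k := by omega
  rw [h1, mul_pow, ← map_pow, ← mul_assoc, coeff_mul_X_pow', if_pos (by omega), h2,
    mul_comm, coeff_C_mul, coeff_map, RingHom.comp_apply, coeff_rescale,
    ← coe_substAlgHom (hasSubst_X_mul σ)]
  rfl

/-- Differentiation of the coefficients. -/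
noncomputable def coeffDerivative (F : K⟦X⟧⟦X⟧) : K⟦X⟧⟦X⟧ :=
  mk fun n => d⁄dX K (coeff n F)

theorem coeffDerivative_mul (F G : K⟦X⟧⟦X⟧) :
    coeffDerivative (F * G) = coeffDerivative F * G + F * coeffDerivative G := by
  ext1 n
  rw [coeffDerivative, coeff_mk, map_add, coeff_mul, coeff_mul, coeff_mul, map_sum,
    ← Finset.sum_add_distrib]
  refine Finset.sum_congr rfl fun p _ => ?_
  rw [derivative_mul, coeffDerivative, coeffDerivative, coeff_mk, coeff_mk]
  ring

theorem coeffDerivative_sub (F G : K⟦X⟧⟦X⟧) :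
    coeffDerivative (F - G) = coeffDerivative F - coeffDerivative G := by
  ext1 n
  simp [coeffDerivative]

theorem coeffDerivative_map_C (f : K⟦X⟧) : coeffDerivative (map C f) = 0 := by
  ext1 n
  simp [coeffDerivative]

theorem coeffDerivative_C (f : K⟦X⟧) : coeffDerivative (C f) = C (d⁄dX K f) := by
  ext1 n
  rw [coeffDerivative, coeff_mk, coeff_C, coeff_C]
  split_ifs <;> simp

variable [CharZero K]

/-- Lagrange inversion, applied to each `ψ^j` with `1 ≤ j ≤ m`; higher powers do not reach degree
`m`. -/
theorem coeff_posPart_subst (hσ : constantCoeff σ = 1) (h : ρ.subst (X * σ) = σ) (k m : ℕ) :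
    coeff m ((posPart ρ k).subst (X * σ)) = ∑ j ∈ Finset.Icc 1 m,
      coeff (k + j) (ρ ^ k) * ((j : K) * ((m : K)⁻¹ * coeff (m - j) (ρ ^ m))) := by
  obtain ⟨r, hr⟩ := pow_dvd_subst_sub_sum (posPart ρ k) (g := X * σ) (by simp) (m + 1)
  rw [sub_eq_iff_eq_add.1 hr, map_add, mul_pow, mul_assoc, coeff_X_pow_mul', if_neg (by omega),
    zero_add, map_sum, Finset.sum_range_succ']
  have h0 : coeff m (C (coeff 0 (posPart ρ k)) * (X * σ) ^ 0) = 0 := by simp [posPart]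
  rw [h0, add_zero, ← Finset.Ico_add_one_right_eq_Icc, Finset.sum_Ico_eq_sum_range,
    Nat.add_sub_cancel]
  refine Finset.sum_congr rfl fun j hj => ?_
  have hj' := Finset.mem_range.1 hj
  have hm : (m : K) ≠ 0 := Nat.cast_ne_zero.2 (by omega)
  have hL := lagrange_inversion hσ h (m - (j + 1)) j
  have hm' : m - (j + 1) + j + 1 = m := by omega
  rw [hm'] at hL
  rw [coeff_C_mul, posPart, coeff_mk, if_neg (by omega), add_comm 1 j, mul_left_comm (_ : K) (m : K)⁻¹,
    ← hL, inv_mul_cancel_left₀ hm]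

theorem coeff_bivEval_posLog (hσ : constantCoeff σ = 1) (h : ρ.subst (X * σ) = σ) (a b : K)
    (N : ℕ) :
    coeff N (bivEval σ a b (posLog ρ)) = ∑ p ∈ Finset.HasAntidiagonal.antidiagonal N,
      a ^ p.2 * b ^ p.1 * ∑ j ∈ Finset.Icc 1 p.1, (j : K) *
        ((p.2 : K)⁻¹ * coeff (p.2 + j) (ρ ^ p.2)) *
          ((p.1 : K)⁻¹ * coeff (p.1 - j) (ρ ^ p.1)) := by
  rw [coeff_bivEval]
  refine Finset.sum_congr rfl fun p _ => ?_
  have hC : (C (p.2 : K)⁻¹ : K⟦X⟧).subst (X * σ) = C (p.2 : K)⁻¹ := subst_C _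
  rw [posLog, coeff_mk, subst_mul (hasSubst_X_mul σ), hC, coeff_C_mul,
    coeff_posPart_subst hσ h, mul_assoc, Finset.mul_sum]
  congr 2
  refine Finset.sum_congr rfl fun j _ => ?_
  ring

theorem bivEval_exp (a b : K) :
    bivEval σ a b ((exp K⟦X⟧).subst (-posLog ρ)) = (exp K).subst (-bivEval σ a b (posLog ρ)) := by
  rw [map_exp_subst, map_neg]
  · rw [bivEval_X]; exact dvd_mul_left _ _
  · rw [map_neg, constantCoeff_posLog, neg_zero]

/-- At `z = ψ(b s)` one has `z = b s σ(b s)` and `ρ(z) = σ(b s)`, so `z - a s ρ(z) = (b - a) s σ(b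
s)`. For `a = b` the identity is void, whence `bivEval_exp_self`. -/
theorem bivEval_exp_mul (hσ : constantCoeff σ = 1) (h : ρ.subst (X * σ) = σ) {a b : K}
    (ha : a ≠ 0) :
    bivEval σ a b ((exp K⟦X⟧).subst (-posLog ρ)) *
        (rescale b (X * σ) - rescale a (X * σ)) =
      C (b - a) * X * rescale b σ * rescale a σ := by
  have h1 := congrArg (bivEval σ a b) (exp_posLog_mul hσ h)
  simp only [map_mul, map_sub, bivEval_C, bivEval_X, map_X, h, subst_X (hasSubst_X_mul σ)] at h1
  have h2 := bivEval_map_C (σ := σ) a b σ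
  rw [h2] at h1
  simp only [map_mul, map_sub, rescale_X] at h1 ⊢
  have : (C a * X : K⟦X⟧) ≠ 0 := mul_ne_zero (by simpa using ha) X_ne_zero
  apply mul_right_cancel₀ this
  linear_combination h1

theorem bivEval_exp_self (hσ : constantCoeff σ = 1) (h : ρ.subst (X * σ) = σ) {a : K}
    (ha : a ≠ 0) :
    bivEval σ a a ((exp K⟦X⟧).subst (-posLog ρ)) =
      (1 - C a * X * rescale a ((d⁄dX K ρ).subst (X * σ))) * rescale a σ := by
  have hX : coeffDerivative (X : K⟦X⟧⟦X⟧) = 0 := by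
    rw [← map_X (C : K →+* K⟦X⟧), coeffDerivative_map_C]
  -- After differentiation in `z`, the term containing the derivative of the exponential still has
  -- the factor `z - ψ(x)`, which vanishes at this point.
  have h1 := congrArg (fun F => bivEval σ a a (coeffDerivative F)) (exp_posLog_mul hσ h)
  have h2 := bivEval_map_C (σ := σ) a a σ
  simp only [coeffDerivative_mul, coeffDerivative_sub, coeffDerivative_C, coeffDerivative_map_C,
    hX, derivative_X, map_add, map_mul, map_sub, bivEval_C, bivEval_X, map_X, h2,
    subst_X (hasSubst_X_mul σ), rescale_X, map_zero, map_one] at h1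
  have : (C a * X : K⟦X⟧) ≠ 0 := mul_ne_zero (by simpa using ha) X_ne_zero
  apply mul_right_cancel₀ this
  linear_combination h1

end Bivariate

end PowerSeries

/-! ### Products and power sums of the `e`-th roots of `r` -/

section Roots

variable {L : Type*} [Field L] {e : ℕ} {r : L} {c : Fin e → L}

open Polynomial in
theorem nodal_eq_X_pow_sub_C (he : 0 < e) (hinj : Function.Injective c) (hc : ∀ i, c i ^ e = r) :
    Lagrange.nodal Finset.univ c = (X ^ e - C r : L[X]) := by
  classical
  refine Polynomial.eq_of_degree_sub_lt_of_eval_finset_eq (Finset.univ.image c) ?_ ?_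
  · rw [Finset.card_image_of_injective _ hinj, Finset.card_univ, Fintype.card_fin]
    have hd : (Lagrange.nodal Finset.univ c).degree = e := by
      rw [Lagrange.degree_nodal, Finset.card_univ, Fintype.card_fin]
    rw [← hd]
    refine degree_sub_lt_left ?_ Lagrange.nodal_ne_zero ?_
    · rw [hd, degree_X_pow_sub_C he]
    · rw [Lagrange.nodal_monic.leadingCoeff, leadingCoeff_X_pow_sub_C he]
  · intro x hx
    obtain ⟨i, -, rfl⟩ := Finset.mem_image.1 hx
    rw [Lagrange.eval_nodal_at_node (Finset.mem_univ i)]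
    simp [hc]

theorem prod_sub_eq (he : 0 < e) (hinj : Function.Injective c) (hc : ∀ i, c i ^ e = r)
    (i : Fin e) :
    ∏ j ∈ Finset.univ.erase i, (c i - c j) = e * c i ^ (e - 1) := by
  rw [← Lagrange.eval_nodal, ← Lagrange.eval_nodal_derivative_eval_node_eq (Finset.mem_univ i),
    nodal_eq_X_pow_sub_C he hinj hc]
  simp [Polynomial.derivative_X_pow]

theorem exists_eq_of_pow_eq (he : 0 < e) (hinj : Function.Injective c) (hc : ∀ i, c i ^ e = r)
    {x : L} (hx : x ^ e = r) : ∃ i, c i = x := by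
  have h : (Lagrange.nodal Finset.univ c).eval x = 0 := by
    rw [nodal_eq_X_pow_sub_C he hinj hc]; simp [hx]
  rw [Lagrange.eval_nodal, Finset.prod_eq_zero_iff] at h
  obtain ⟨i, -, hi⟩ := h
  exact ⟨i, (sub_eq_zero.1 hi).symm⟩

/-- Multiplication by a quotient `ω` of two roots permutes the roots, hence multiplies the sum by
`ω^n` without changing it. It suffices to find `ω` with `ω^n ≠ 1`. -/
theorem sum_pow_eq_zero (he : 0 < e) (hinj : Function.Injective c) (hc : ∀ i, c i ^ e = r)
    (hr : r ≠ 0) {n : ℕ} (h : ¬ e ∣ n) : ∑ i, c i ^ n = 0 := by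
  classical
  have hc0 : ∀ i, c i ≠ 0 := fun i hi => hr (by rw [← hc i, hi, zero_pow he.ne'])
  let o : Fin e := ⟨0, he⟩
  obtain ⟨i, hi⟩ : ∃ i, c i ^ n ≠ c o ^ n := by
    -- Otherwise all `e` roots have the same power of exponent `n % e`, which is positive and less
    -- than `e`: too many roots.
    by_contra! hall
    have hm : 0 < n % e := Nat.pos_of_ne_zero fun h' => h (Nat.dvd_of_mod_eq_zero h')
    have hpow : ∀ i, c i ^ n = r ^ (n / e) * c i ^ (n % e) := fun i => by
      rw [← hc i, ← pow_mul, ← pow_add, Nat.div_add_mod]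
    have hsub : Finset.univ.image c ⊆ (Polynomial.nthRoots (n % e) (c o ^ (n % e))).toFinset := by
      intro x hx
      obtain ⟨i, -, rfl⟩ := Finset.mem_image.1 hx
      rw [Multiset.mem_toFinset, Polynomial.mem_nthRoots hm]
      have := hall i
      rw [hpow, hpow] at this
      exact mul_left_cancel₀ (pow_ne_zero _ hr) this
    have h1 := Finset.card_le_card hsub
    rw [Finset.card_image_of_injective _ hinj, Finset.card_univ, Fintype.card_fin] at h1
    have h2 := (Multiset.toFinset_card_le _).trans
      (Polynomial.card_nthRoots (n % e) (c o ^ (n % e)))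
    exact absurd (h1.trans h2) (not_le.2 (Nat.mod_lt n he))
  set ω := c i / c o with hω
  have hωe : ω ^ e = 1 := by rw [hω, div_pow, hc, hc, div_self hr]
  have hωn : ω ^ n ≠ 1 := by
    rw [hω, div_pow, Ne, div_eq_one_iff_eq (pow_ne_zero _ (hc0 o))]; exact hi
  have hω0 : ω ≠ 0 := div_ne_zero (hc0 i) (hc0 o)
  choose f hf using fun j => exists_eq_of_pow_eq he hinj hc (x := ω * c j)
    (by rw [mul_pow, hωe, hc, one_mul])
  have hfi : Function.Injective f := fun j k hjk => hinj <| mul_left_cancel₀ hω0 <| by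
    rw [← hf, ← hf, hjk]
  have hsum : ∑ j, c j ^ n = ω ^ n * ∑ j, c j ^ n := by
    rw [Finset.mul_sum, ← Equiv.sum_comp (Equiv.ofBijective f (Finite.injective_iff_bijective.1 hfi))]
    refine Finset.sum_congr rfl fun j _ => ?_
    rw [Equiv.ofBijective_apply, hf, mul_pow]
  have : (ω ^ n - 1) * ∑ j, c j ^ n = 0 := by linear_combination -hsum
  exact (mul_eq_zero.1 this).resolve_left (sub_ne_zero.2 hωn)

theorem sum_pow_mul (hc : ∀ i, c i ^ e = r) (n : ℕ) : ∑ i, c i ^ (n * e) = e * r ^ n := by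
  simp [mul_comm n e, pow_mul, hc]

end Roots

/-! ### `G e R` as a product over pairs of roots -/

namespace NewtonPuiseux

open PowerSeries

theorem map_exponentSeries {K L : Type*} [Field K] [Field L] [Algebra K L] (e : ℕ) (R : K⟦X⟧) :
    map (algebraMap K L) (exponentSeries e R) = exponentSeries e (map (algebraMap K L) R) := by
  ext N
  simp [exponentSeries, ← map_pow, coeff_map]

theorem map_G {K L : Type*} [Field K] [CharZero K] [Field L] [CharZero L] [Algebra K L] (e : ℕ)
    (R : K⟦X⟧) : map (algebraMap K L) (G e R) = G e (map (algebraMap K L) R) := by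
  have h := map_subst (hasSubst_neg_exponentSeries e R) (h := algebraMap K L) (exp K)
  rw [map_exp] at h
  rw [G, G, ← map_exponentSeries, ← map_neg]
  exact h

section

variable {L : Type*} [Field L] [CharZero L] {e : ℕ} {r : L} {c : Fin e → L} {ρ σ : L⟦X⟧}

/-- The power sums of the `c i` select exponents `m e` and `n e`, with weight `e² r^(m+n)`: here
`e²` turns `1/(me) · 1/(ne)` into `1/m · 1/n`, and `r^(m+n)` turns powers of `ρ^e` into powers of `r
ρ^e`. -/
theorem exponentSeries_subst (he : 0 < e) (hinj : Function.Injective c) (hc : ∀ i, c i ^ e = r)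
    (hr : r ≠ 0) (hσ : constantCoeff σ = 1) (h : ρ.subst (X * σ) = σ) :
    (exponentSeries e (C r * ρ ^ e)).subst (X ^ e : L⟦X⟧) =
      ∑ i, ∑ j, bivEval σ (c i) (c j) (posLog ρ) := by
  ext N
  set A : ℕ × ℕ → L := fun p => ∑ j ∈ Finset.Icc 1 p.1, (j : L) *
        ((p.2 : L)⁻¹ * coeff (p.2 + j) (ρ ^ p.2)) *
          ((p.1 : L)⁻¹ * coeff (p.1 - j) (ρ ^ p.1)) with hA
  have h1 : coeff N (∑ i, ∑ j, bivEval σ (c i) (c j) (posLog ρ)) =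
      ∑ p ∈ Finset.HasAntidiagonal.antidiagonal N,
        (∑ i, c i ^ p.2) * (∑ j, c j ^ p.1) * A p := by
    simp only [map_sum, coeff_bivEval_posLog hσ h]
    rw [Finset.sum_congr rfl fun i _ => Finset.sum_comm, Finset.sum_comm]
    refine Finset.sum_congr rfl fun p _ => ?_
    rw [Finset.sum_mul_sum, Finset.sum_mul]
    refine Finset.sum_congr rfl fun i _ => ?_
    rw [Finset.sum_mul]
  rw [h1, coeff_subst_X_pow he.ne']
  split_ifs with hN
  · obtain ⟨M, rfl⟩ := hN
    rw [Nat.mul_div_cancel_left M he, exponentSeries, coeff_mk, Algebra.algebraMap_self_apply]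
    have he' : (e : L) ≠ 0 := Nat.cast_ne_zero.2 he.ne'
    have hterm : ∀ p : ℕ × ℕ, (∑ i, c i ^ (p.2 * e)) * (∑ j, c j ^ (p.1 * e)) *
        A (p.1 * e, p.2 * e) = ∑ j ∈ Finset.Icc 1 (p.1 * e),
        (j : L) * ((1 / (p.2 : L)) * coeff (p.2 * e + j) ((C r * ρ ^ e) ^ p.2)) *
          ((1 / (p.1 : L)) * coeff (p.1 * e - j) ((C r * ρ ^ e) ^ p.1)) := by
      intro p
      rw [sum_pow_mul hc, sum_pow_mul hc, hA, Finset.mul_sum]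
      refine Finset.sum_congr rfl fun j _ => ?_
      rw [mul_pow, mul_pow, ← map_pow, ← map_pow, coeff_C_mul, coeff_C_mul, ← pow_mul, ← pow_mul,
        mul_comm e, mul_comm e]
      push_cast
      rw [mul_inv, mul_inv]
      field_simp
    simp_rw [← hterm]
    rw [Finset.sum_filter_of_ne]
    · symm
      rw [← Finset.sum_subset (s₁ := (Finset.HasAntidiagonal.antidiagonal M).image
        fun p => (p.1 * e, p.2 * e)), Finset.sum_image]
      · intro p _ q _ hpq
        simp only [Prod.mk.injEq, Nat.mul_left_inj he.ne'] at hpq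
        exact Prod.ext hpq.1 hpq.2
      · intro p hp
        obtain ⟨q, hq, rfl⟩ := Finset.mem_image.1 hp
        have := Finset.HasAntidiagonal.mem_antidiagonal.1 hq
        rw [Finset.HasAntidiagonal.mem_antidiagonal, ← this]
        ring
      · intro p hp hp'
        have hpM := Finset.HasAntidiagonal.mem_antidiagonal.1 hp
        by_cases h2 : e ∣ p.2
        · obtain ⟨b, hb⟩ := h2
          have h3 : e ∣ p.1 := (Nat.dvd_add_left ⟨b, hb⟩).1 (hpM ▸ dvd_mul_right e M)
          obtain ⟨a, ha⟩ := h3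
          refine absurd (Finset.mem_image.2 ⟨(a, b), ?_, ?_⟩) hp'
          · rw [Finset.HasAntidiagonal.mem_antidiagonal]
            apply Nat.eq_of_mul_eq_mul_left he
            rw [← hpM, ha, hb]; ring
          · exact Prod.ext (ha ▸ mul_comm a e) (hb ▸ mul_comm b e)
        · rw [sum_pow_eq_zero he hinj hc hr h2, zero_mul, zero_mul]
    · intro p _ hp
      by_contra hcon
      apply hp
      -- If `p.1 = 0` the range of `j` is empty; if `p.2 = 0` the factor `(p.2)⁻¹` is `0` by
      -- convention.
      have : p.1 = 0 ∨ p.2 = 0 := by omega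
      rcases this with h0 | h0 <;> simp [hA, h0]
  · refine (Finset.sum_eq_zero fun p hp => ?_).symm
    have hpM := Finset.HasAntidiagonal.mem_antidiagonal.1 hp
    by_cases h2 : e ∣ p.2
    · have h3 : ¬ e ∣ p.1 := fun h3 => hN (hpM ▸ dvd_add h3 h2)
      rw [sum_pow_eq_zero he hinj hc hr h3, mul_zero, zero_mul]
    · rw [sum_pow_eq_zero he hinj hc hr h2, zero_mul, zero_mul]

theorem constantCoeff_exponentSeries {K : Type*} [Field K] (e : ℕ) (R : K⟦X⟧) :
    constantCoeff (exponentSeries e R) = 0 := by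
  rw [← PowerSeries.coeff_zero_eq_constantCoeff_apply]
  simp [exponentSeries, Finset.filter_singleton]

theorem constantCoeff_bivEval_posLog (hσ : constantCoeff σ = 1) (h : ρ.subst (X * σ) = σ)
    (a b : L) : constantCoeff (bivEval σ a b (posLog ρ)) = 0 := by
  rw [← coeff_zero_eq_constantCoeff_apply, coeff_bivEval_posLog hσ h]
  simp

theorem G_subst (he : 0 < e) (hinj : Function.Injective c) (hc : ∀ i, c i ^ e = r)
    (hr : r ≠ 0) (hσ : constantCoeff σ = 1) (h : ρ.subst (X * σ) = σ) :
    (G e (C r * ρ ^ e)).subst (X ^ e : L⟦X⟧) =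
      ∏ i, ∏ j, bivEval σ (c i) (c j) ((exp L⟦X⟧).subst (-posLog ρ)) := by
  have hX : HasSubst (X ^ e : L⟦X⟧) := HasSubst.X_pow he.ne'
  have h1 := map_exp_subst (substAlgHom (R := L) hX).toRingHom
    (by
      change X ∣ substAlgHom (R := L) hX X
      rw [coe_substAlgHom, subst_X hX]; exact dvd_pow_self X he.ne')
    (g := -exponentSeries e (C r * ρ ^ e)) (by rw [map_neg, constantCoeff_exponentSeries, neg_zero])
  have h2 : ∀ f : L⟦X⟧, (substAlgHom (R := L) hX).toRingHom f = f.subst (X ^ e : L⟦X⟧) := fun f => by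
    rw [← coe_substAlgHom hX]; rfl
  rw [map_neg, h2, h2, exponentSeries_subst he hinj hc hr hσ h] at h1
  rw [G, h1, ← Finset.sum_neg_distrib, exp_subst_sum]
  · refine Finset.prod_congr rfl fun i _ => ?_
    rw [← Finset.sum_neg_distrib, exp_subst_sum]
    · exact Finset.prod_congr rfl fun j _ => (bivEval_exp _ _).symm
    · intro j _
      rw [map_neg, constantCoeff_bivEval_posLog hσ h, neg_zero]
  · intro i _
    rw [map_neg, map_sum, neg_eq_zero]
    exact Finset.sum_eq_zero fun j _ => constantCoeff_bivEval_posLog hσ h _ _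

end

end NewtonPuiseux

/-! ### Orders, substitution and roots of constants in Hahn series -/

namespace HahnSeries

variable {L : Type*} [Field L]

theorem zero_le_orderTop_iff_coeff {x : HahnSeries ℚ L} :
    0 ≤ x.orderTop ↔ ∀ g < 0, x.coeff g = 0 := by
  constructor
  · intro h g hg
    exact coeff_eq_zero_of_lt_orderTop (lt_of_lt_of_le (by exact_mod_cast hg) h)
  · intro h
    by_contra hx
    rw [not_le] at hx
    have hx0 : x ≠ 0 := by rintro rfl; simp at hx
    rw [← order_eq_orderTop_of_ne_zero hx0] at hx
    exact coeff_order_eq_zero.not.2 hx0 (h _ (by exact_mod_cast hx))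

theorem zero_lt_orderTop_iff_coeff {x : HahnSeries ℚ L} :
    0 < x.orderTop ↔ ∀ g ≤ 0, x.coeff g = 0 := by
  constructor
  · intro h g hg
    exact coeff_eq_zero_of_lt_orderTop (lt_of_le_of_lt (by exact_mod_cast hg) h)
  · intro h
    by_contra hx
    rw [not_lt] at hx
    have hx0 : x ≠ 0 := by rintro rfl; simp at hx
    rw [← order_eq_orderTop_of_ne_zero hx0] at hx
    exact coeff_order_eq_zero.not.2 hx0 (h _ (by exact_mod_cast hx))

theorem zero_le_orderTop_add {x y : HahnSeries ℚ L} (hx : 0 ≤ x.orderTop) (hy : 0 ≤ y.orderTop) :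
    0 ≤ (x + y).orderTop :=
  (le_min hx hy).trans min_orderTop_le_orderTop_add

theorem zero_le_orderTop_mul {x y : HahnSeries ℚ L} (hx : 0 ≤ x.orderTop) (hy : 0 ≤ y.orderTop) :
    0 ≤ (x * y).orderTop :=
  (add_nonneg hx hy).trans orderTop_add_le_mul

theorem zero_lt_orderTop_mul {x y : HahnSeries ℚ L} (hx : 0 < x.orderTop) (hy : 0 ≤ y.orderTop) :
    0 < (x * y).orderTop :=
  (add_pos_of_pos_of_nonneg hx hy).trans_le orderTop_add_le_mul

theorem zero_le_orderTop_C (a : L) : 0 ≤ (C a : HahnSeries ℚ L).orderTop :=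
  zero_le_orderTop_iff_coeff.2 fun g hg => by rw [C_apply, coeff_single_of_ne hg.ne]

theorem zero_le_orderTop_heval (x : HahnSeries ℚ L) (f : PowerSeries L) :
    0 ≤ (PowerSeries.heval x f).orderTop := by
  refine zero_le_orderTop_iff_coeff.2 fun g hg => ?_
  rw [PowerSeries.coeff_heval, finsum_eq_zero_of_forall_eq_zero]
  intro n
  simp only [SummableFamily.coeff_apply, SummableFamily.smulFamily_toFun, HahnSeries.coeff_smul,
    smul_eq_mul]
  refine mul_eq_zero_of_right _ (coeff_eq_zero_of_lt_orderTop ?_)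
  refine lt_of_lt_of_le (b := 0) (by exact_mod_cast hg) ?_
  by_cases h : 0 < x.orderTop
  · rw [SummableFamily.powers_of_orderTop_pos h]
    exact (nsmul_nonneg h.le n).trans orderTop_nsmul_le_orderTop_pow
  -- If the order of `x` is not positive, the family of powers has default values, those of the
  -- powers of `0`.
  · by_cases hn : n = 0 <;> simp [h, hn]

theorem zero_lt_orderTop_heval {x : HahnSeries ℚ L} (hx : 0 < x.orderTop) {f : PowerSeries L}
    (hf : PowerSeries.constantCoeff f = 0) : 0 < (PowerSeries.heval x f).orderTop := by
  obtain ⟨f', rfl⟩ := PowerSeries.X_dvd_iff.2 hf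
  rw [map_mul, PowerSeries.heval_X x hx]
  exact zero_lt_orderTop_mul hx (zero_le_orderTop_heval x f')

theorem eq_zero_of_forall_pow_dvd {x y : HahnSeries ℚ L} (hy : 0 < y.orderTop)
    (h : ∀ N : ℕ, ∃ w : HahnSeries ℚ L, 0 ≤ w.orderTop ∧ x = y ^ N * w) : x = 0 := by
  by_cases hy0 : y = 0
  · obtain ⟨w, -, hw⟩ := h 1
    rw [hw, hy0]; simp
  rw [← order_eq_orderTop_of_ne_zero hy0] at hy
  have hy' : 0 < y.order := by exact_mod_cast hy
  ext g
  obtain ⟨N, hN⟩ := exists_lt_nsmul hy' g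
  obtain ⟨w, hw, rfl⟩ := h N
  refine coeff_eq_zero_of_lt_orderTop (lt_of_lt_of_le ?_ orderTop_add_le_mul)
  have h1 : ((N • y.order : ℚ) : WithTop ℚ) ≤ (y ^ N).orderTop := by
    refine le_trans (le_of_eq ?_) orderTop_nsmul_le_orderTop_pow
    rw [← order_eq_orderTop_of_ne_zero hy0]; rfl
  calc (g : WithTop ℚ) < ((N • y.order : ℚ) : WithTop ℚ) := by exact_mod_cast hN
    _ ≤ _ := h1
    _ ≤ _ := le_add_of_nonneg_right hw

/-- A homomorphism from power series to Hahn series with values of order at least `0` is determined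
by the image of `X`, if that has positive order. -/
theorem ringHom_powerSeries_ext {φ φ' : PowerSeries L →+* HahnSeries ℚ L}
    (hC : ∀ a, φ (PowerSeries.C a) = φ' (PowerSeries.C a))
    (hX : φ PowerSeries.X = φ' PowerSeries.X) (h0 : 0 < (φ PowerSeries.X).orderTop)
    (hφ : ∀ f, 0 ≤ (φ f).orderTop) (hφ' : ∀ f, 0 ≤ (φ' f).orderTop) (f : PowerSeries L) :
    φ f = φ' f := by
  rw [← sub_eq_zero]
  refine eq_zero_of_forall_pow_dvd h0 fun N => ?_
  set f' : PowerSeries L := PowerSeries.mk fun i => PowerSeries.coeff (i + N) f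
  refine ⟨φ f' - φ' f', ?_, ?_⟩
  · rw [sub_eq_add_neg]
    exact zero_le_orderTop_add (hφ _) (by rw [orderTop_neg]; exact hφ' _)
  · have hP : φ.comp Polynomial.coeToPowerSeries.ringHom =
        φ'.comp Polynomial.coeToPowerSeries.ringHom := by
      refine Polynomial.ringHom_ext ?_ ?_
      · intro a; simpa using hC a
      · simpa using hX
    have hT := congrArg (fun ψ => ψ (PowerSeries.trunc N f)) hP
    simp only [RingHom.comp_apply, Polynomial.coeToPowerSeries.ringHom_apply] at hT
    rw [PowerSeries.eq_X_pow_mul_shift_add_trunc N f]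
    simp only [map_add, map_mul, map_pow, hT, hX]
    ring

theorem heval_C_eq (x : HahnSeries ℚ L) (a : L) : PowerSeries.heval x (PowerSeries.C a) = C a := by
  rw [PowerSeries.heval_C]
  ext g
  by_cases hg : g = 0 <;> simp [hg, coeff_one]

/-- Both sides are homomorphisms in `f` with values of non-negative order, and they agree on
constants and on `X`. -/
theorem heval_heval {x : HahnSeries ℚ L} (hx : 0 < x.orderTop) {g : PowerSeries L}
    (hg : PowerSeries.constantCoeff g = 0) (f : PowerSeries L) :
    PowerSeries.heval (PowerSeries.heval x g) f = PowerSeries.heval x (f.subst g) := by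
  have hs : PowerSeries.HasSubst g := PowerSeries.HasSubst.of_constantCoeff_zero' hg
  have hy := zero_lt_orderTop_heval hx hg
  have := ringHom_powerSeries_ext
    (φ := RingHomClass.toRingHom (PowerSeries.heval (PowerSeries.heval x g)))
    (φ' := (RingHomClass.toRingHom (PowerSeries.heval x)).comp
      (RingHomClass.toRingHom (PowerSeries.substAlgHom (R := L) hs)))
    (fun a => ?_) ?_ ?_ (fun f => zero_le_orderTop_heval _ _) (fun f => zero_le_orderTop_heval _ _) f
  · rw [← PowerSeries.coe_substAlgHom hs]
    exact this
  · change PowerSeries.heval _ (PowerSeries.C a) =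
      PowerSeries.heval x (PowerSeries.substAlgHom (R := L) hs (PowerSeries.C a))
    have : PowerSeries.substAlgHom (R := L) hs (PowerSeries.C a) = PowerSeries.C a :=
      (PowerSeries.substAlgHom (R := L) hs).commutes a
    rw [this, heval_C_eq, heval_C_eq]
  · change PowerSeries.heval _ PowerSeries.X =
      PowerSeries.heval x (PowerSeries.substAlgHom (R := L) hs PowerSeries.X)
    rw [PowerSeries.heval_X _ hy, PowerSeries.coe_substAlgHom, PowerSeries.subst_X hs]
  · change 0 < (PowerSeries.heval (PowerSeries.heval x g) PowerSeries.X).orderTop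
    rwa [PowerSeries.heval_X _ hy]

theorem ofPowerSeries_eq_heval {x : HahnSeries ℚ L} (hx : 0 < x.orderTop) {e : ℕ} (he : e ≠ 0)
    (hxe : x ^ e = single 1 1) (f : PowerSeries L) :
    ofPowerSeries ℚ L f = PowerSeries.heval x (f.subst (PowerSeries.X ^ e : PowerSeries L)) := by
  have hc : PowerSeries.constantCoeff (PowerSeries.X ^ e : PowerSeries L) = 0 := by simp [he]
  rw [← heval_heval hx hc, map_pow, PowerSeries.heval_X x hx, hxe]
  have h1 : (0 : WithTop ℚ) < (single 1 1 : HahnSeries ℚ L).orderTop := by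
    rw [orderTop_single one_ne_zero]; exact_mod_cast one_pos
  refine ringHom_powerSeries_ext (φ := ofPowerSeries ℚ L)
    (φ' := RingHomClass.toRingHom (PowerSeries.heval (single 1 1 : HahnSeries ℚ L))) (fun a => ?_) ?_ ?_ ?_
    (fun f => zero_le_orderTop_heval _ _) f
  · rw [ofPowerSeries_C]; exact (heval_C_eq _ a).symm
  · rw [ofPowerSeries_X]; exact (PowerSeries.heval_X _ h1).symm
  · rwa [ofPowerSeries_X]
  · intro f
    refine zero_le_orderTop_iff_coeff.2 fun g hg => ?_
    rw [ofPowerSeries_apply]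
    refine embDomain_of_notMem_range ?_
    rintro ⟨n, rfl⟩
    exact absurd hg (not_lt.2 (Nat.cast_nonneg n))

theorem one_add_pow_eq {w : HahnSeries ℚ L} (hw : 0 ≤ w.orderTop) (n : ℕ) :
    ∃ T : HahnSeries ℚ L, 0 ≤ T.orderTop ∧ (1 + w) ^ n = 1 + w * (n + w * T) := by
  induction n with
  | zero => exact ⟨0, by simp, by simp⟩
  | succ n ih =>
    obtain ⟨T, hT, h⟩ := ih
    refine ⟨n + (T + w * T), ?_, ?_⟩
    · refine zero_le_orderTop_add ?_ (zero_le_orderTop_add hT (zero_le_orderTop_mul hw hT))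
      rw [← map_natCast (C : L →+* HahnSeries ℚ L)]
      exact zero_le_orderTop_C _
    · rw [pow_succ, h]; push_cast; ring

/-- Since `v` has order `0`, it is `c (1 + w)` with `c ≠ 0` and `w` of positive order. Comparing
constant terms gives `c^e = r`, and then `w (e + w T) = 0`, where the second factor has constant
term `e ≠ 0`. No assumption that `L` contains the roots of `r` is needed. -/
theorem exists_eq_C_of_pow_eq [CharZero L] {e : ℕ} (he : 0 < e) {r : L} (hr : r ≠ 0)
    {v : HahnSeries ℚ L} (hv : v ^ e = C r) : ∃ c, c ^ e = r ∧ v = C c := by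
  have hv0 : v ≠ 0 := by
    rintro rfl
    rw [zero_pow he.ne'] at hv
    exact hr (by simpa using hv.symm)
  have hord : v.order = 0 := by
    have h := congrArg order hv
    rw [order_pow, order_C, nsmul_eq_mul] at h
    exact (mul_eq_zero.1 h).resolve_left (Nat.cast_ne_zero.2 he.ne')
  set c := v.coeff 0 with hcdef
  have hc : c ≠ 0 := by rw [hcdef, ← hord]; exact coeff_order_eq_zero.not.2 hv0
  have hw : 0 < (v - C c).orderTop := by
    refine zero_lt_orderTop_iff_coeff.2 fun g hg => ?_
    rcases hg.lt_or_eq with hg | rfl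
    · rw [coeff_sub, C_apply, coeff_single_of_ne hg.ne, sub_zero]
      exact coeff_eq_zero_of_lt_order (by rwa [hord])
    · rw [coeff_sub, C_apply, coeff_single_same, sub_self]
  have hw' : 0 < ((v - C c) * C c⁻¹).orderTop := zero_lt_orderTop_mul hw (zero_le_orderTop_C _)
  set w := (v - C c) * C c⁻¹ with hwdef
  have hcc : (C c⁻¹ : HahnSeries ℚ L) * C c = 1 := by
    rw [← map_mul, inv_mul_cancel₀ hc, map_one]
  have hvw : v = C c * (1 + w) := by
    rw [hwdef]; linear_combination (C c - v) * hcc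
  obtain ⟨T, hT, hpow⟩ := one_add_pow_eq hw'.le e
  have h0 : C (c ^ e) * (1 + w * ((e : HahnSeries ℚ L) + w * T)) = C r := by
    rw [← hpow, map_pow, ← mul_pow, ← hvw, hv]
  have he0 : 0 ≤ (e : HahnSeries ℚ L).orderTop := by
    rw [← map_natCast (C : L →+* HahnSeries ℚ L)]
    exact zero_le_orderTop_C _
  have hu : 0 < (w * ((e : HahnSeries ℚ L) + w * T) * C (c ^ e)).orderTop :=
    zero_lt_orderTop_mul (zero_lt_orderTop_mul hw'
      (zero_le_orderTop_add he0 (zero_le_orderTop_mul hw'.le hT))) (zero_le_orderTop_C _)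
  have hcr : c ^ e = r := by
    have h1 : w * ((e : HahnSeries ℚ L) + w * T) * C (c ^ e) = C (r - c ^ e) := by
      rw [map_sub]; linear_combination h0
    rw [h1] at hu
    have h2 := zero_lt_orderTop_iff_coeff.1 hu 0 le_rfl
    rw [C_apply, coeff_single_same, sub_eq_zero] at h2
    exact h2.symm
  refine ⟨c, hcr, ?_⟩
  have h3 : C r * (w * ((e : HahnSeries ℚ L) + w * T)) = 0 := by
    rw [hcr] at h0; linear_combination h0
  rcases mul_eq_zero.1 ((mul_eq_zero.1 h3).resolve_left (C_ne_zero hr)) with h4 | h4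
  · rw [hvw, h4, add_zero, mul_one]
  · exfalso
    have h5 := zero_lt_orderTop_iff_coeff.1 (zero_lt_orderTop_mul hw' hT) 0 le_rfl
    rw [eq_neg_of_add_eq_zero_right h4, ← map_natCast (C : L →+* HahnSeries ℚ L), coeff_neg,
      C_apply, coeff_single_same, neg_eq_zero] at h5
    exact he.ne' (Nat.cast_eq_zero.1 h5)

end HahnSeries

/-! ### The product of all factors, and the description of the solutions -/

namespace NewtonPuiseux

open PowerSeries

/-- Used with `S i = ρ(H i)` and `D i = ρ'(H i)`. Column `j` of the product contributes `e (c_j s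
S_j)^(e-1) = e H_j^(e-1)`, the factor `1 - c_j s D_j`, the inverse differences and `∏ i, S i`. As
`c_j s = H_j / S_j`, the first two combine to `H_j^e (e / H_j - R'(H_j) / R(H_j))`. -/
theorem prod_prod_eq_of_mul_sub_eq {F : Type*} [Field F] {e : ℕ} (he : 0 < e) {H S D c : Fin e → F}
    {s r : F} {E : Fin e → Fin e → F} (hr : r ≠ 0) (hs : s ≠ 0) (hc : ∀ i, c i ≠ 0)
    (hS : ∀ i, S i ≠ 0) (hinj : Function.Injective H) (hH : ∀ i, H i = c i * s * S i)
    (hE : ∀ i j, E i j * (H j - H i) = (c j - c i) * s * S j * S i)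
    (hE' : ∀ i, E i i = (1 - c i * s * D i) * S i)
    (hprod : ∀ j, ∏ i ∈ Finset.univ.erase j, (c j - c i) = e * c j ^ (e - 1)) :
    ∏ i, ∏ j, E i j = (∏ i, r * S i ^ e / r) * (∏ i, H i ^ e) *
      (∏ p ∈ (Finset.univ : Finset (Fin e × Fin e)).filter (fun p => p.1 ≠ p.2),
        1 / (H p.2 - H p.1)) *
      ∏ i, ((e : F) / H i - r * (e * S i ^ (e - 1) * D i) / (r * S i ^ e)) := by
  have hD : (∏ p ∈ (Finset.univ : Finset (Fin e × Fin e)).filter (fun p => p.1 ≠ p.2),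
        1 / (H p.2 - H p.1)) = ∏ j, ∏ i ∈ Finset.univ.erase j, 1 / (H j - H i) := by
    rw [Finset.prod_filter, Fintype.prod_prod_type_right]
    refine Finset.prod_congr rfl fun j _ => ?_
    rw [← Finset.prod_filter]
    refine Finset.prod_congr ?_ fun _ _ => rfl
    ext i; simp
  rw [hD, Finset.prod_comm]
  obtain ⟨k, rfl⟩ := Nat.exists_eq_succ_of_ne_zero he.ne'
  simp only [Nat.succ_eq_add_one, Nat.add_sub_cancel] at *
  have hcol : ∀ j, ∏ i, E i j = ((1 - c j * s * D j) * (((k + 1 : ℕ) : F) * c j ^ k) * s ^ k *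
      S j ^ k * ∏ i ∈ Finset.univ.erase j, 1 / (H j - H i)) * ∏ i, S i := by
    intro j
    have h1 : ∏ i ∈ Finset.univ.erase j, E i j = ∏ i ∈ Finset.univ.erase j,
        ((c j - c i) * (s * S j) * S i * (1 / (H j - H i))) := by
      refine Finset.prod_congr rfl fun i hi => ?_
      have hij : H j - H i ≠ 0 :=
        sub_ne_zero.2 fun h => (Finset.mem_erase.1 hi).1 (hinj h).symm
      rw [mul_one_div, eq_div_iff hij, hE]; ring
    rw [← Finset.mul_prod_erase _ _ (Finset.mem_univ j), hE', h1, Finset.prod_mul_distrib,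
      Finset.prod_mul_distrib, Finset.prod_mul_distrib, hprod, Finset.prod_const,
      Finset.card_erase_of_mem (Finset.mem_univ j), Finset.card_univ, Fintype.card_fin,
      Nat.succ_sub_one, ← Finset.mul_prod_erase _ S (Finset.mem_univ j), mul_pow]
    ring
  have hSS : ∏ _j : Fin (k + 1), ∏ i, S i = ∏ j, S j ^ (k + 1) := by
    rw [Finset.prod_const, Finset.card_univ, Fintype.card_fin, Finset.prod_pow]
  rw [Finset.prod_congr rfl fun j _ => hcol j, Finset.prod_mul_distrib, hSS,
    ← Finset.prod_mul_distrib, ← Finset.prod_mul_distrib, ← Finset.prod_mul_distrib,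
    ← Finset.prod_mul_distrib]
  refine Finset.prod_congr rfl fun j _ => ?_
  have h1 := hc j
  have h2 := hS j
  rw [hH j]
  generalize (∏ i ∈ Finset.univ.erase j, 1 / (c j * s * S j - H i)) = P
  field_simp
  ring

section

variable {L : Type*} [Field L] {e : ℕ} {r : L} {ρ σ : L⟦X⟧}

theorem heval_heval_rescale {x : HahnSeries ℚ L} (hx : 0 < x.orderTop) (c : L) (f : L⟦X⟧) :
    heval (heval x (rescale c (X * σ))) f = heval x (rescale c (f.subst (X * σ))) := by
  have h1 : HasSubst (c • X : L⟦X⟧) := HasSubst.smul_X' c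
  rw [HahnSeries.heval_heval hx (by simp), rescale_eq_subst, rescale_eq_subst,
    subst_comp_subst_apply (hasSubst_X_mul σ) h1]

/-- The series `q ^ (1 / e)`. -/
noncomputable def root (L : Type*) [Field L] (e : ℕ) : HahnSeries ℚ L :=
  HahnSeries.single (1 / (e : ℚ)) 1

theorem root_pow (he : 0 < e) : root L e ^ e = HahnSeries.single 1 1 := by
  have : (e : ℚ) ≠ 0 := Nat.cast_ne_zero.2 he.ne'
  rw [root, HahnSeries.single_pow, one_pow, nsmul_eq_mul, mul_one_div_cancel this]

theorem zero_lt_orderTop_root (he : 0 < e) : 0 < (root L e).orderTop := by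
  rw [root, HahnSeries.orderTop_single one_ne_zero]
  have : (0 : ℚ) < 1 / (e : ℚ) := by positivity
  exact_mod_cast this

theorem root_ne_zero : root L e ≠ 0 := HahnSeries.single_ne_zero one_ne_zero

theorem coeff_heval_root (he : 0 < e) (f : L⟦X⟧) (g : ℚ) :
    (heval (root L e) f).coeff g = ∑ᶠ n : ℕ, if g = n / e then coeff n f else 0 := by
  rw [coeff_heval]
  congr 1
  ext n
  rw [HahnSeries.SummableFamily.coeff_apply,
    HahnSeries.SummableFamily.powerSeriesFamily_of_orderTop_pos (zero_lt_orderTop_root he), root,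
    HahnSeries.single_pow, HahnSeries.coeff_smul, HahnSeries.coeff_single, nsmul_eq_mul,
    mul_one_div]
  split_ifs <;> simp

theorem heval_root_injective (he : 0 < e) : Function.Injective (heval (root L e)) := by
  intro f g hfg
  have key : ∀ (f : L⟦X⟧) (m : ℕ), (heval (root L e) f).coeff (m / e) = coeff m f := by
    intro f m
    have he' : (e : ℚ) ≠ 0 := Nat.cast_ne_zero.2 he.ne'
    rw [coeff_heval_root he, finsum_eq_single _ m, if_pos rfl]
    intro n hn
    rw [if_neg]
    intro h
    rw [div_left_inj' he', Nat.cast_inj] at h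
    exact hn h.symm
  ext m
  rw [← key, ← key, hfg]

theorem isPuiseux_heval_root (he : 0 < e) (f : L⟦X⟧) : IsPuiseux (heval (root L e) f) := by
  refine ⟨e, he, fun a ha => ?_⟩
  by_contra! h
  refine ha ?_
  rw [coeff_heval_root he, finsum_eq_zero_of_forall_eq_zero]
  intro n
  rw [if_neg]
  simpa using h n

theorem heval_root_rescale_injective (he : 0 < e) (hσ : constantCoeff σ = 1) :
    Function.Injective fun c : L => heval (root L e) (rescale c (X * σ)) := by
  intro a b hab
  have h1 := congrArg (coeff 1) (heval_root_injective he hab)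
  have h2 : coeff 1 (X * σ) = 1 := by
    rw [← zero_add 1, coeff_succ_X_mul]; simp [hσ]
  rw [coeff_rescale, coeff_rescale, h2] at h1
  simpa using h1

variable [CharZero L]

/-- `X * σ` is the compositional inverse of `X * ρ⁻¹`. One composite yields `ρ(ψ) = σ` after
cancelling `X`; the other, `ψ(z / ρ(z)) = z`, recovers a solution from `H / ρ(H)`. -/
theorem exists_root_and_inverse (he : 0 < e) {R : L⟦X⟧} (hR : constantCoeff R ≠ 0) :
    ∃ ρ σ : L⟦X⟧, R = C (constantCoeff R) * ρ ^ e ∧ constantCoeff ρ = 1 ∧ constantCoeff σ = 1 ∧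
      ρ.subst (X * σ) = σ ∧ (X * σ).subst (X * ρ⁻¹) = X := by
  set r := constantCoeff R with hr
  have hrr : (C r : L⟦X⟧) * C r⁻¹ = 1 := by rw [← map_mul, mul_inv_cancel₀ hR, map_one]
  obtain ⟨ρ, hρ, hρ1⟩ := exists_pow_eq he.ne' (f := C r⁻¹ * R)
    (by rw [map_mul, constantCoeff_C, ← hr, inv_mul_cancel₀ hR])
  have hφ0 : constantCoeff (X * ρ⁻¹) = 0 := by simp
  have hφ1 : coeff 1 (X * ρ⁻¹) = 1 := by
    rw [← zero_add 1, coeff_succ_X_mul]; simp [hρ1]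
  have hφu : IsUnit (coeff 1 (X * ρ⁻¹)) := by rw [hφ1]; exact isUnit_one
  obtain ⟨σ, hσ⟩ := X_dvd_iff.2 (constantCoeff_substInvOfIsUnit (X * ρ⁻¹) hφu)
  have hs : HasSubst (X * σ : L⟦X⟧) := HasSubst.of_constantCoeff_zero' (by simp)
  have h1 := subst_substInvOfIsUnit_right (X * ρ⁻¹) hφ0 hφu
  have h2 := subst_substInvOfIsUnit_left (X * ρ⁻¹) hφ0 hφu
  rw [hσ] at h1 h2
  have hρi : ρ * ρ⁻¹ = 1 := PowerSeries.mul_inv_cancel ρ (by rw [hρ1]; exact one_ne_zero)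
  have h3 : ρ.subst (X * σ) * ρ⁻¹.subst (X * σ) = (1 : L⟦X⟧) := by
    rw [← subst_mul hs, hρi, ← coe_substAlgHom hs, map_one]
  have h4 : σ * ρ⁻¹.subst (X * σ) = (1 : L⟦X⟧) := by
    rw [subst_mul hs, subst_X hs, mul_assoc] at h1
    exact mul_left_cancel₀ X_ne_zero (h1.trans (mul_one X).symm)
  have h5 : ρ.subst (X * σ) = σ :=
    mul_right_cancel₀ (right_ne_zero_of_mul_eq_one h4) (h3.trans h4.symm)
  refine ⟨ρ, σ, ?_, hρ1, ?_, h5, h2⟩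
  · rw [hρ, ← mul_assoc, hrr, one_mul]
  · obtain ⟨t, ht⟩ := pow_dvd_subst_sub_sum ρ (g := X * σ) (by simp) 1
    rw [h5] at ht
    have := congrArg constantCoeff ht
    simp [hρ1] at this
    linear_combination this

theorem equation_iff (he : 0 < e) (hr : r ≠ 0) (hρ : constantCoeff ρ = 1)
    (h : ρ.subst (X * σ) = σ) (h' : (X * σ).subst (X * ρ⁻¹) = X) {H : HahnSeries ℚ L} :
    (0 < H.orderTop ∧ H ^ e = HahnSeries.single (1 : ℚ) (1 : L) * heval H (C r * ρ ^ e)) ↔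
      ∃ c, c ^ e = r ∧ H = heval (root L e) (rescale c (X * σ)) := by
  have hs := zero_lt_orderTop_root (L := L) he
  constructor
  · rintro ⟨hH, heq⟩
    have hρi : ρ * ρ⁻¹ = 1 := PowerSeries.mul_inv_cancel ρ (by rw [hρ]; exact one_ne_zero)
    have hy : heval H (X * ρ⁻¹) ^ e = HahnSeries.single (1 : ℚ) (1 : L) * HahnSeries.C r := by
      have h1 : heval H ρ * heval H ρ⁻¹ = 1 := by rw [← map_mul, hρi, map_one]
      have h2 : heval H ρ ^ e * heval H ρ⁻¹ ^ e = 1 := by rw [← mul_pow, h1, one_pow]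
      rw [map_mul, heval_X H hH, mul_pow, heq, map_mul, map_pow, HahnSeries.heval_C_eq]
      linear_combination HahnSeries.single (1 : ℚ) (1 : L) * HahnSeries.C r * h2
    -- `H / (ρ(H) q^(1/e))` has `e`-th power `r`, so it is a constant `c`, and `H = ψ(H / ρ(H)) =
    -- ψ(c q^(1/e))`.
    obtain ⟨c, hc, hv⟩ := HahnSeries.exists_eq_C_of_pow_eq he hr
      (v := heval H (X * ρ⁻¹) / root L e) (by
        rw [div_pow, hy, root_pow he, mul_div_cancel_left₀]
        exact HahnSeries.single_ne_zero one_ne_zero)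
    refine ⟨c, hc, ?_⟩
    rw [div_eq_iff root_ne_zero] at hv
    have h3 := HahnSeries.heval_heval hH (g := X * ρ⁻¹) (by simp) (X * σ)
    rw [h', heval_X H hH, hv] at h3
    have hX : heval (root L e) (C c * X) = HahnSeries.C c * root L e := by
      rw [map_mul, heval_X _ hs, HahnSeries.heval_C_eq]
    rw [← h3, rescale_eq_subst, ← HahnSeries.heval_heval hs (by simp), smul_eq_C_mul, hX]
  · rintro ⟨c, hc, rfl⟩
    refine ⟨HahnSeries.zero_lt_orderTop_heval hs (by simp), ?_⟩
    have hr' : (C r).subst (X * σ) = (C r : L⟦X⟧) := subst_C r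
    have hr'' : rescale c (C r) = C r := by
      ext n; rw [coeff_rescale, coeff_C]; split_ifs with hn <;> simp [hn]
    rw [heval_heval_rescale hs, subst_mul (hasSubst_X_mul σ), subst_pow (hasSubst_X_mul σ), h, hr']
    simp only [map_mul, map_pow, rescale_X]
    rw [hr'', heval_X _ hs, HahnSeries.heval_C_eq, HahnSeries.heval_C_eq, mul_pow, mul_pow,
      root_pow he, ← map_pow, hc]
    ring

end

/-! ### Counting the solutions and proving the identity -/

section

variable {K L : Type*} [Field K] [Field L] [CharZero L] [Algebra K L] {e : ℕ} {R : K⟦X⟧}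
  {r : L} {ρ σ : L⟦X⟧}

/-- The Puiseux condition is automatic: every solution of positive order among Hahn series is a
power series in `q^(1/e)`. -/
theorem mem_solutions_iff (he : 0 < e) (hr : r ≠ 0) (hR : map (algebraMap K L) R = C r * ρ ^ e)
    (hρ : constantCoeff ρ = 1) (h : ρ.subst (X * σ) = σ) (h' : (X * σ).subst (X * ρ⁻¹) = X)
    {H : HahnSeries ℚ L} :
    H ∈ solutions L e R ↔ ∃ c, c ^ e = r ∧ H = heval (root L e) (rescale c (X * σ)) := by
  rw [← equation_iff he hr hρ h h', solutions, Set.mem_ofPred_eq, evalAt, hR]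
  refine ⟨fun hH => hH.2, fun hH => ⟨?_, hH⟩⟩
  obtain ⟨c, -, rfl⟩ := (equation_iff he hr hρ h h').1 hH
  exact isPuiseux_heval_root he _

theorem ncard_solutions [IsAlgClosed L] (he : 0 < e) (hr : r ≠ 0)
    (hR : map (algebraMap K L) R = C r * ρ ^ e) (hρ : constantCoeff ρ = 1)
    (hσ : constantCoeff σ = 1) (h : ρ.subst (X * σ) = σ) (h' : (X * σ).subst (X * ρ⁻¹) = X) :
    (solutions L e R).ncard = e := by
  classical
  have h1 : solutions L e R = (fun c : L => heval (root L e) (rescale c (X * σ))) ''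
      ((Polynomial.nthRoots e r).toFinset : Set L) := by
    ext H
    rw [mem_solutions_iff he hr hR hρ h h']
    simp only [Set.mem_image, Finset.mem_coe, Multiset.mem_toFinset, Polynomial.mem_nthRoots he]
    simp only [eq_comm]
  rw [h1, Set.ncard_image_of_injective _ (heval_root_rescale_injective he hσ), Set.ncard_coe_finset,
    Polynomial.nthRoots, Multiset.toFinset_card_of_nodup (Polynomial.nodup_roots
      (Polynomial.separable_X_pow_sub_C r (Nat.cast_ne_zero.2 he.ne') hr)),
    Polynomial.splits_iff_card_roots.1 (IsAlgClosed.splits _), Polynomial.natDegree_X_pow_sub_C]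

theorem toHahn_G_eq [CharZero K] (he : 0 < e) (hr : r ≠ 0)
    (hR : map (algebraMap K L) R = C r * ρ ^ e) (hρ : constantCoeff ρ = 1)
    (hσ : constantCoeff σ = 1) (h : ρ.subst (X * σ) = σ) (h' : (X * σ).subst (X * ρ⁻¹) = X)
    {H : Fin e → HahnSeries ℚ L} (hinj : Function.Injective H) (hH : ∀ i, H i ∈ solutions L e R) :
    toHahn L (G e R) =
      (∏ i, evalAt R (H i) / HahnSeries.C r) * (∏ i, H i ^ e) *
        (∏ p ∈ (Finset.univ : Finset (Fin e × Fin e)).filter (fun p => p.1 ≠ p.2),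
          1 / (H p.2 - H p.1)) *
        ∏ i, ((e : HahnSeries ℚ L) / H i -
          evalAt (PowerSeries.derivative K R) (H i) / evalAt R (H i)) := by
  have hs := zero_lt_orderTop_root (L := L) he
  choose c hc hHc using fun i => (mem_solutions_iff he hr hR hρ h h').1 (hH i)
  have hcinj : Function.Injective c := fun i j hij => hinj (by rw [hHc, hHc, hij])
  have hc0 : ∀ i, c i ≠ 0 := fun i hi => hr (by rw [← hc i, hi, zero_pow he.ne'])
  have hC : ∀ (a b : L), rescale a (C b) = C b := fun a b => by
    ext n; rw [coeff_rescale, coeff_C]; split_ifs with hn <;> simp [hn]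
  have hsC : (C r).subst (X * σ) = (C r : L⟦X⟧) := subst_C r
  have hRH : ∀ i, evalAt R (H i) =
      HahnSeries.C r * heval (root L e) (rescale (c i) σ) ^ e := by
    intro i
    rw [evalAt, hR, hHc, heval_heval_rescale hs, subst_mul (hasSubst_X_mul σ),
      subst_pow (hasSubst_X_mul σ), h, hsC, map_mul, map_pow, hC, map_mul, map_pow,
      HahnSeries.heval_C_eq]
  have hR' : map (algebraMap K L) (PowerSeries.derivative K R) =
      C r * (C (e : L) * ρ ^ (e - 1) * d⁄dX L ρ) := by
    rw [← derivative_map, hR, derivative_mul, derivative_C, derivative_pow, map_natCast]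
    ring
  have hsC' : (C (e : L)).subst (X * σ) = (C (e : L) : L⟦X⟧) := subst_C _
  have hRH' : ∀ i, evalAt (PowerSeries.derivative K R) (H i) =
      HahnSeries.C r * ((e : HahnSeries ℚ L) * heval (root L e) (rescale (c i) σ) ^ (e - 1) *
        heval (root L e) (rescale (c i) ((d⁄dX L ρ).subst (X * σ)))) := by
    intro i
    rw [evalAt, hR', hHc, heval_heval_rescale hs, subst_mul (hasSubst_X_mul σ),
      subst_mul (hasSubst_X_mul σ), subst_mul (hasSubst_X_mul σ),
      subst_pow (hasSubst_X_mul σ), h, hsC, hsC']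
    simp only [map_mul, map_pow]
    rw [hC, hC, HahnSeries.heval_C_eq, HahnSeries.heval_C_eq, map_natCast]
  simp only [hRH, hRH']
  rw [toHahn, map_G, hR, HahnSeries.ofPowerSeries_eq_heval hs he.ne' (root_pow he),
    G_subst he hcinj hc hr hσ h]
  simp only [map_prod]
  have hX : ∀ a : L, heval (root L e) (C a * X) = HahnSeries.C a * root L e := fun a => by
    rw [map_mul, heval_X _ hs, HahnSeries.heval_C_eq]
  refine prod_prod_eq_of_mul_sub_eq he (c := fun i => HahnSeries.C (c i)) (s := root L e)
    (HahnSeries.C_ne_zero hr) root_ne_zero (fun i => HahnSeries.C_ne_zero (hc0 i)) ?_ hinj ?_ ?_ ?_ ?_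
  · intro i hi
    have := heval_root_injective he (hi.trans (map_zero _).symm)
    have := congrArg constantCoeff this
    rw [← coeff_zero_eq_constantCoeff_apply, coeff_rescale, coeff_zero_eq_constantCoeff_apply,
      hσ] at this
    simp at this
  · intro i
    rw [hHc, map_mul, rescale_X, map_mul, hX]
  · intro i j
    rw [hHc, hHc, ← map_sub, ← map_mul, bivEval_exp_mul hσ h (hc0 i), map_mul, map_mul, hX, map_sub]
  · intro i
    rw [bivEval_exp_self hσ h (hc0 i), map_mul, map_sub, map_mul, hX, map_one]
  · intro j
    have := congrArg (HahnSeries.C : L →+* HahnSeries ℚ L) (prod_sub_eq he hcinj hc j)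
    rwa [map_prod, map_mul, map_natCast, map_pow, Finset.prod_congr rfl fun i _ => map_sub _ _ _] at this

end

end NewtonPuiseux

theorem mainTheorem1 {K L : Type*} [Field K] [CharZero K] [Field L] [Algebra K L]
    (e : ℕ) (he : 0 < e) (R : PowerSeries K) (hR : PowerSeries.constantCoeff R ≠ 0) :
    (IsAlgClosed L → (NewtonPuiseux.solutions L e R).ncard = e) ∧
    ∀ H : Fin e → HahnSeries ℚ L, Function.Injective H →
      (∀ i, H i ∈ NewtonPuiseux.solutions L e R) →
      NewtonPuiseux.toHahn L (NewtonPuiseux.G e R) =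
        (∏ i, NewtonPuiseux.evalAt R (H i) /
            HahnSeries.C (algebraMap K L (PowerSeries.constantCoeff R))) *
          (∏ i, H i ^ e) *
          (∏ p ∈ (Finset.univ : Finset (Fin e × Fin e)).filter (fun p => p.1 ≠ p.2),
            1 / (H p.2 - H p.1)) *
          ∏ i, ((e : HahnSeries ℚ L) / H i -
            NewtonPuiseux.evalAt (PowerSeries.derivative K R) (H i) /
              NewtonPuiseux.evalAt R (H i)) := by
  have : CharZero L := charZero_of_injective_algebraMap (algebraMap K L).injective
  have hc : PowerSeries.constantCoeff (PowerSeries.map (algebraMap K L) R) =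
      algebraMap K L (PowerSeries.constantCoeff R) := by
    rw [← PowerSeries.coeff_zero_eq_constantCoeff_apply, PowerSeries.coeff_map,
      PowerSeries.coeff_zero_eq_constantCoeff_apply]
  have hr : algebraMap K L (PowerSeries.constantCoeff R) ≠ 0 := by simpa using hR
  obtain ⟨ρ, σ, hRρ, hρ, hσ, h, h'⟩ :=
    NewtonPuiseux.exists_root_and_inverse he (R := PowerSeries.map (algebraMap K L) R)
      (by rw [hc]; exact hr)
  rw [hc] at hRρ
  exact ⟨fun _ => NewtonPuiseux.ncard_solutions he hr hRρ hρ hσ h h',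
    fun H hinj hH => NewtonPuiseux.toHahn_G_eq he hr hRρ hρ hσ h h' hinj hH⟩
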